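/- Let $\ell>0$ (the length of an arc $\gamma$ of a network) and let $H=H_\gamma\colon[0,\ell]\times[0,\infty)\times\mathbb R\to\mathbb R$, $(s,t,\mu)\mapsto H(s,t,\mu)$, satisfy: 1. $H$ is continuous, and convex in $\mu$; 2. for every $T>0$ there are nondecreasing, convex functions $\vartheta_T,\Theta_T\colon[0,\infty)\to\mathbb R$ with $\vartheta_T(r)/r\to\infty$ and $\Theta_T(r)/r\to\infty$ as $r\to\infty$, such that $\vartheta_T(|\mu|)\le H(s,t,\mu)\le\Theta_T(|\mu|)$ for all $s\in[0,\ell]$, $t\in[0,T]$, $\mu\in\mathbb R$; 3. for every $T>0$ there are $\alpha_T,\beta_T\ge0$ and $\epsilon_T\in(0,T]$ such that $$H(s,t_1,\mu)-H(s,t_2,\mu)\le\Big(\alpha_T\frac{H(s,t_2,\mu)}{1+|\mu|}+\beta_T\Big)|t_2-t_1|$$ for all $s\in[0,\ell]$, $\mu\in\mathbb R$ and $t_1,t_2\in[0,T]$ with $|t_2-t_1|<\epsilon_T$. Let $L(s,\lambda,t)=\max_{\mu\in\mathbb R}\{\lambda\mu-H(s,t,\mu)\}$ be the Lagrangian, let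 $\mathcal Q=(0,\ell)\times(0,\infty)$, and let $\partial_p^+\mathcal Q=([0,\ell]\times\{0\})\cup(\{\ell\}\times[0,\infty))$ be the partial parabolic boundary. A continuous $W\colon\overline{\mathcal Q}\to\mathbb R$ is a subsolution of $$\partial_tW+H(s,t,\partial_sW)=0\quad\text{in }\mathcal Q\qquad(\mathrm{HJ}_\gamma)$$ if $\partial_t\psi(s,t)+H(s,t,\partial_s\psi(s,t))\le0$ whenever $\psi$ is a $C^1$ function on $\mathcal Q$ and $W-\psi$ has a local maximum at $(s,t)\in\mathcal Q$ (viscosity sense). Given a continuous $U_0\colon\partial_p^+\mathcal Q\to\mathbb R$, define for $(s,t)\in\overline{\mathcal Q}=[0,\ell]\times[0,\infty)$ $$U(s,t)=\inf\Big\{U_0(\eta(t_0),t_0)+\int_{t_0}^tL(\eta(\tau),\dot\eta(\tau),\tau)\,d\tau\Big\},$$ the infimum being over all $t_0\in[0,t]$ and all absolutely continuous curves $\eta\colon[t_0,t]\to[0,\ell]$ with $\eta(t)=s$ and $(\eta(t_0),t_0)\in\partial_p^+\mathcal Q$. Theorem. The infimum defining $U$ is finite at every point of $\overline{\mathcal Q}$,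 and $U$ is the maximal continuous subsolution of $(\mathrm{HJ}_\gamma)$ that is less than or equal to $U_0$ on $\partial_p^+\mathcal Q$. That is, $U$ is continuous on $\overline{\mathcal Q}$, is a subsolution of $(\mathrm{HJ}_\gamma)$, satisfies $U\le U_0$ on $\partial_p^+\mathcal Q$, and every continuous subsolution $W\colon\overline{\mathcal Q}\to\mathbb R$ of $(\mathrm{HJ}_\gamma)$ with $W\le U_0$ on $\partial_p^+\mathcal Q$ satisfies $W\le U$ on $\overline{\mathcal Q}$. -/

import Mathlib

open Set Filter MeasureTheory Topology

noncomputable section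

/-- The standing assumptions on the Hamiltonian `H s t μ` of an arc of length `ℓ`
(`s` is the arc-length parameter, `t` the time, `μ` the momentum). -/
structure IsArcHamiltonian (ℓ : ℝ) (H : ℝ → ℝ → ℝ → ℝ) : Prop where
  /-- `H` is continuous on `[0, ℓ] × [0, ∞) × ℝ`. -/
  continuousOn : ContinuousOn (fun p : ℝ × ℝ × ℝ => H p.1 p.2.1 p.2.2)
    (Icc 0 ℓ ×ˢ Ici 0 ×ˢ univ)
  /-- `H` is convex in the momentum. -/
  convexOn : ∀ s ∈ Icc 0 ℓ, ∀ t : ℝ, 0 ≤ t → ConvexOn ℝ univ (H s t)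
  /-- On every bounded time interval `H` lies between two nondecreasing, convex, superlinearly
  coercive functions of `|μ|`. -/
  coercive : ∀ T : ℝ, 0 < T → ∃ θ Θ : ℝ → ℝ,
    (MonotoneOn θ (Ici 0) ∧ ConvexOn ℝ (Ici 0) θ ∧ Tendsto (fun r => θ r / r) atTop atTop) ∧
    (MonotoneOn Θ (Ici 0) ∧ ConvexOn ℝ (Ici 0) Θ ∧ Tendsto (fun r => Θ r / r) atTop atTop) ∧
    ∀ s ∈ Icc 0 ℓ, ∀ t ∈ Icc 0 T, ∀ μ : ℝ, θ |μ| ≤ H s t μ ∧ H s t μ ≤ Θ |μ|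
  /-- The Lipschitz-type condition in time. -/
  time_lipschitz : ∀ T : ℝ, 0 < T → ∃ α β ε : ℝ, 0 ≤ α ∧ 0 ≤ β ∧ ε ∈ Ioc 0 T ∧
    ∀ s ∈ Icc 0 ℓ, ∀ μ : ℝ, ∀ t₁ ∈ Icc 0 T, ∀ t₂ ∈ Icc 0 T, |t₂ - t₁| < ε →
      H s t₁ μ - H s t₂ μ ≤ (α * (H s t₂ μ / (1 + |μ|)) + β) * |t₂ - t₁|

/-- The Lagrangian `L(s, v, t) = max_μ (v μ - H(s, t, μ))`. -/
def arcLagrangian (H : ℝ → ℝ → ℝ → ℝ) (s v t : ℝ) : ℝ :=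
  ⨆ μ : ℝ, (v * μ - H s t μ)

/-- The open strip `(0, ℓ) × (0, ∞)`. -/
def arcStrip (ℓ : ℝ) : Set (ℝ × ℝ) := Ioo 0 ℓ ×ˢ Ioi 0

/-- The closed strip `[0, ℓ] × [0, ∞)`. -/
def closedArcStrip (ℓ : ℝ) : Set (ℝ × ℝ) := Icc 0 ℓ ×ˢ Ici 0

/-- The partial parabolic boundary `([0, ℓ] × {0}) ∪ ({ℓ} × [0, ∞))`. -/
def rightParabolicBoundary (ℓ : ℝ) : Set (ℝ × ℝ) :=
  (Icc 0 ℓ ×ˢ {0}) ∪ ({ℓ} ×ˢ Ici 0)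

/-- `W` is a viscosity subsolution of `∂ₜ W + H(s, t, ∂ₛ W) = 0` in `(0, ℓ) × (0, ∞)`: whenever a
`C¹` function `ψ` touches `W` from above at a point (up to an additive constant), `ψ` satisfies
the inequality `≤ 0` at that point. -/
def IsViscositySubsolution (ℓ : ℝ) (H : ℝ → ℝ → ℝ → ℝ) (W : ℝ × ℝ → ℝ) : Prop :=
  ∀ ψ : ℝ × ℝ → ℝ, ContDiffOn ℝ 1 ψ (arcStrip ℓ) →
    ∀ s t : ℝ, (s, t) ∈ arcStrip ℓ → IsLocalMax (fun p => W p - ψ p) (s, t) →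
      deriv (fun r => ψ (s, r)) t + H s t (deriv (fun r => ψ (r, t)) s) ≤ 0

/-- The costs over which the value function at `(s, t)` is minimised: the starting time is
`t₀ ∈ [0, t]`, and `η` is an absolutely continuous curve in `[0, ℓ]` with `η t = s` that starts
on the partial parabolic boundary. As the Lagrangian is bounded below along `η`, a curve whose
action is not integrable has action `+∞` and does not affect the infimum. -/
def arcCosts (ℓ : ℝ) (H : ℝ → ℝ → ℝ → ℝ) (U₀ : ℝ × ℝ → ℝ) (s t : ℝ) : Set ℝ :=
  {c | ∃ (t₀ : ℝ) (η : ℝ → ℝ), t₀ ∈ Icc 0 t ∧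
    AbsolutelyContinuousOnInterval η t₀ t ∧ (∀ τ ∈ Icc t₀ t, η τ ∈ Icc 0 ℓ) ∧ η t = s ∧
    (η t₀, t₀) ∈ rightParabolicBoundary ℓ ∧
    IntervalIntegrable (fun τ => arcLagrangian H (η τ) (deriv η τ) τ) volume t₀ t ∧
    c = U₀ (η t₀, t₀) + ∫ τ in t₀..t, arcLagrangian H (η τ) (deriv η τ) τ}

/-- The local value function. -/
def arcValueFunction (ℓ : ℝ) (H : ℝ → ℝ → ℝ → ℝ) (U₀ : ℝ × ℝ → ℝ) (p : ℝ × ℝ) : ℝ :=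
  sInf (arcCosts ℓ H U₀ p.1 p.2)

end

/-! The value function lies above every admissible subsolution `W` because `W` grows along a curve
at most by its action (`IsViscositySubsolution.sub_le_action`). For segments in the open strip this
is a viscosity argument: if the growth exceeded the action, a penalized test function would touch
`W` at an interior point and contradict the Fenchel inequality. Contracting towards the midpoint and
shifting time extends the estimate to closed segments. For absolutely continuous curves a chain rule
is needed, but `W` is only continuous. Its integral over a time window `[t, t + h]` is Lipschitz,
and it satisfies the segment inequality up to an error of order `h ^ 2`, because `L` is Lipschitz in
time with constant `K * (1 + |v|)`. Integrating its derivative along the curve, dividing by `h` and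
letting `h → 0` gives the claim for `W`.

The value function is itself a subsolution: a competitor may be prolonged by any segment, and the
velocity is chosen to give equality in the Fenchel inequality. Continuity combines two one-sided
estimates. Forward in time, points in a unit-speed cone are reached at bounded cost. Backward in
time, an almost optimal curve is delayed by `δ`; superlinearity of `L` makes these curves
equicontinuous, which controls the change of the starting point. -/

namespace IsArcHamiltonian

variable {ℓ : ℝ} {H : ℝ → ℝ → ℝ → ℝ}

/-! ### Bounds on the Hamiltonian and the Lagrangian. -/

theorem exists_le (hH : IsArcHamiltonian ℓ H) {T : ℝ} (hT : 0 < T) (k : ℝ) :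
    ∃ C : ℝ, ∀ s ∈ Icc 0 ℓ, ∀ t ∈ Icc 0 T, ∀ μ : ℝ, |μ| ≤ k → H s t μ ≤ C := by
  obtain ⟨θ, Θ, -, ⟨hΘ, -, -⟩, hb⟩ := hH.coercive T hT
  refine ⟨Θ k, fun s hs t ht μ hμ => (hb s hs t ht μ).2.trans ?_⟩
  exact hΘ (abs_nonneg μ) ((abs_nonneg μ).trans hμ) hμ

theorem exists_ge (hH : IsArcHamiltonian ℓ H) {T : ℝ} (hT : 0 < T) :
    ∃ C : ℝ, ∀ s ∈ Icc 0 ℓ, ∀ t ∈ Icc 0 T, ∀ μ : ℝ, C ≤ H s t μ := by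
  obtain ⟨θ, Θ, ⟨hθ, -, -⟩, -, hb⟩ := hH.coercive T hT
  refine ⟨θ 0, fun s hs t ht μ => le_trans ?_ (hb s hs t ht μ).1⟩
  exact hθ self_mem_Ici (abs_nonneg μ) (abs_nonneg μ)

theorem exists_superlinear (hH : IsArcHamiltonian ℓ H) {T : ℝ} (hT : 0 < T) (R C : ℝ) :
    ∃ M : ℝ, 0 ≤ M ∧ ∀ s ∈ Icc 0 ℓ, ∀ t ∈ Icc 0 T, ∀ μ : ℝ, M ≤ |μ| → R * |μ| + C ≤ H s t μ := by
  obtain ⟨θ, Θ, ⟨-, -, hθ⟩, -, hb⟩ := hH.coercive T hT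
  -- The slope `R + |C|` absorbs the constant `C` once `1 ≤ |μ|`.
  obtain ⟨M, hM⟩ := eventually_atTop.1 (hθ.eventually_ge_atTop (R + |C|))
  refine ⟨max M 1, by positivity, fun s hs t ht μ hμ => le_trans ?_ (hb s hs t ht μ).1⟩
  have h1 : 1 ≤ |μ| := (le_max_right _ _).trans hμ
  have h2 := hM |μ| ((le_max_left _ _).trans hμ)
  rw [le_div_iff₀ (by linarith)] at h2
  nlinarith [le_abs_self C, abs_nonneg C]

theorem bddAbove (hH : IsArcHamiltonian ℓ H) {s t : ℝ} (hs : s ∈ Icc 0 ℓ) (ht : 0 ≤ t) (v : ℝ) :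
    BddAbove (range fun μ : ℝ => v * μ - H s t μ) := by
  have hT : 0 < t + 1 := by linarith
  have ht' : t ∈ Icc 0 (t + 1) := ⟨ht, by linarith⟩
  obtain ⟨C, hC⟩ := hH.exists_ge hT
  obtain ⟨M, hM0, hM⟩ := hH.exists_superlinear hT |v| 0
  refine ⟨max 0 (|v| * M - C), ?_⟩
  rintro _ ⟨μ, rfl⟩
  have h1 : v * μ ≤ |v| * |μ| := by rw [← abs_mul]; exact le_abs_self _
  rcases le_total M |μ| with h | h
  · have := hM s hs t ht' μ h
    exact le_max_of_le_left (by simp only; linarith)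
  · have := hC s hs t ht' μ
    have h2 : |v| * |μ| ≤ |v| * M := by gcongr
    exact le_max_of_le_right (by simp only; linarith)

/-- The Fenchel inequality. -/
theorem le_arcLagrangian (hH : IsArcHamiltonian ℓ H) {s t : ℝ} (hs : s ∈ Icc 0 ℓ) (ht : 0 ≤ t)
    (v μ : ℝ) : v * μ - H s t μ ≤ arcLagrangian H s v t :=
  le_ciSup (hH.bddAbove hs ht v) μ

/-- Equality in the Fenchel inequality is attained at a subgradient of the Hamiltonian. -/
theorem exists_arcLagrangian_le (hH : IsArcHamiltonian ℓ H) {s t : ℝ} (hs : s ∈ Icc 0 ℓ)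
    (ht : 0 ≤ t) (μ : ℝ) : ∃ v : ℝ, arcLagrangian H s v t ≤ v * μ - H s t μ := by
  have hc := hH.convexOn s hs t ht
  refine ⟨derivWithin (H s t) (Ioi μ) μ, ciSup_le fun ν => ?_⟩
  have hint : μ ∈ interior (univ : Set ℝ) := by simp
  rcases lt_trichotomy ν μ with h | rfl | h
  · have h1 := (hc.slope_le_leftDeriv_of_mem_interior (mem_univ ν) hint h).trans
      (hc.leftDeriv_le_rightDeriv_of_mem_interior hint)
    rw [slope_def_field, div_le_iff₀ (by linarith)] at h1
    nlinarith
  · simp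
  · have h1 := hc.rightDeriv_le_slope_of_mem_interior hint (mem_univ ν) h
    rw [slope_def_field, le_div_iff₀ (by linarith)] at h1
    nlinarith

/-- Test the supremum at `μ = k` or `μ = -k`, according to the sign of `v`. As `k` is arbitrary,
this is superlinearity of `L`; the case `k = 0` is a lower bound. -/
theorem exists_arcLagrangian_ge (hH : IsArcHamiltonian ℓ H) {T : ℝ} (hT : 0 < T) {k : ℝ}
    (hk : 0 ≤ k) :
    ∃ C : ℝ, 0 ≤ C ∧ ∀ s ∈ Icc 0 ℓ, ∀ t ∈ Icc 0 T, ∀ v : ℝ,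
      k * |v| - C ≤ arcLagrangian H s v t := by
  obtain ⟨C, hC⟩ := hH.exists_le hT k
  refine ⟨max C 0, le_max_right _ _, fun s hs t ht v => ?_⟩
  have hle := le_max_left C 0
  rcases abs_cases v with ⟨h, -⟩ | ⟨h, -⟩
  · have := hH.le_arcLagrangian hs ht.1 v k
    have := hC s hs t ht k (abs_of_nonneg hk).le
    rw [h]; linarith
  · have := hH.le_arcLagrangian hs ht.1 v (-k)
    have := hC s hs t ht (-k) (by rw [abs_neg, abs_of_nonneg hk])
    rw [h]; linarith

/-- Only momenta that do at least as well as `μ = 0` at time `t₂` matter in the supremum. For them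
`H s t₂ μ ≤ |v| * |μ| + C`, so the quotient in the time condition is at most `|v| + |C|`, and the
error is linear in `|v|`. -/
theorem exists_arcLagrangian_time_lipschitz (hH : IsArcHamiltonian ℓ H) {T : ℝ} (hT : 0 < T) :
    ∃ K ε : ℝ, 0 ≤ K ∧ 0 < ε ∧ ∀ s ∈ Icc 0 ℓ, ∀ t₁ ∈ Icc 0 T, ∀ t₂ ∈ Icc 0 T, |t₂ - t₁| < ε →
      ∀ v : ℝ, arcLagrangian H s v t₂ ≤ arcLagrangian H s v t₁ + K * (1 + |v|) * |t₂ - t₁| := by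
  obtain ⟨α, β, ε, hα, hβ, hε, hlip⟩ := hH.time_lipschitz T hT
  obtain ⟨C, hC⟩ := hH.exists_le hT 0
  refine ⟨α * (1 + |C|) + β, ε, by positivity, hε.1, fun s hs t₁ ht₁ t₂ ht₂ h12 v => ?_⟩
  have hgood : ∀ μ : ℝ, -H s t₂ 0 ≤ v * μ - H s t₂ μ → v * μ - H s t₂ μ ≤
      arcLagrangian H s v t₁ + (α * (1 + |C|) + β) * (1 + |v|) * |t₂ - t₁| := by
    intro μ hμ
    have h1 := hH.le_arcLagrangian hs ht₁.1 v μ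
    have h2 := hlip s hs μ t₁ ht₁ t₂ ht₂ h12
    have h3 : H s t₂ μ / (1 + |μ|) ≤ |v| + |C| := by
      rw [div_le_iff₀ (by positivity)]
      have h4 : v * μ ≤ |v| * |μ| := by rw [← abs_mul]; exact le_abs_self _
      have h5 := hC s hs t₂ ht₂ 0 (by simp)
      nlinarith [abs_nonneg v, abs_nonneg μ, abs_nonneg C, le_abs_self C,
        mul_nonneg (abs_nonneg C) (abs_nonneg μ)]
    have h6 : α * (H s t₂ μ / (1 + |μ|)) + β ≤ (α * (1 + |C|) + β) * (1 + |v|) := by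
      have h7 : α * (H s t₂ μ / (1 + |μ|)) ≤ α * (|v| + |C|) := by gcongr
      have h8 : 0 ≤ α * |C| * |v| := by positivity
      have h9 : 0 ≤ β * |v| := by positivity
      nlinarith
    have h10 := mul_le_mul_of_nonneg_right h6 (abs_nonneg (t₂ - t₁))
    linarith
  refine ciSup_le fun μ => ?_
  rcases le_total (-H s t₂ 0) (v * μ - H s t₂ μ) with h | h
  · exact hgood μ h
  · have := hgood 0 (by simp)
    simp only [mul_zero, zero_sub] at this
    exact h.trans this

end IsArcHamiltonian

/-! ### Continuity of the Lagrangian. -/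

/-- The nearest-point retraction of the line onto `[0, ℓ]`. -/
noncomputable def clampArc (ℓ s : ℝ) : ℝ := max 0 (min s ℓ)

theorem clampArc_mem {ℓ : ℝ} (hℓ : 0 ≤ ℓ) (s : ℝ) : clampArc ℓ s ∈ Icc 0 ℓ :=
  ⟨le_max_left _ _, max_le hℓ (min_le_right _ _)⟩

theorem clampArc_of_mem {ℓ s : ℝ} (hs : s ∈ Icc 0 ℓ) : clampArc ℓ s = s := by
  rw [clampArc, min_eq_left hs.2, max_eq_right hs.1]

@[fun_prop]
theorem continuous_clampArc (ℓ : ℝ) : Continuous (clampArc ℓ) := by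
  unfold clampArc; fun_prop

/-- The Lagrangian, extended to all positions and times by composition with retractions. -/
noncomputable def extLagrangian (ℓ : ℝ) (H : ℝ → ℝ → ℝ → ℝ) (s v t : ℝ) : ℝ :=
  arcLagrangian H (clampArc ℓ s) v (max 0 t)

theorem extLagrangian_eq {ℓ s t : ℝ} {H : ℝ → ℝ → ℝ → ℝ} (hs : s ∈ Icc 0 ℓ) (ht : 0 ≤ t) (v : ℝ) :
    extLagrangian ℓ H s v t = arcLagrangian H s v t := by
  rw [extLagrangian, clampArc_of_mem hs, max_eq_right ht]

/-- Locally the supremum may be restricted to a fixed compact interval of momenta, where it is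
continuous in the parameters: outside `[-M, M]` superlinearity makes every momentum no better than
`μ = 0`. -/
theorem IsArcHamiltonian.continuous_extLagrangian {ℓ : ℝ} {H : ℝ → ℝ → ℝ → ℝ} (hℓ : 0 ≤ ℓ)
    (hH : IsArcHamiltonian ℓ H) :
    Continuous fun p : ℝ × ℝ × ℝ => extLagrangian ℓ H p.1 p.2.1 p.2.2 := by
  have hcont : Continuous fun q : (ℝ × ℝ × ℝ) × ℝ =>
      q.1.2.1 * q.2 - H (clampArc ℓ q.1.1) (max 0 q.1.2.2) q.2 := by
    refine Continuous.sub (by fun_prop) ?_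
    exact hH.continuousOn.comp_continuous
      (f := fun q : (ℝ × ℝ × ℝ) × ℝ => (clampArc ℓ q.1.1, max 0 q.1.2.2, q.2)) (by fun_prop)
      fun q => ⟨clampArc_mem hℓ _, le_max_left (0 : ℝ) _, mem_univ _⟩
  rw [continuous_iff_continuousAt]
  rintro ⟨s₀, v₀, t₀⟩
  have hT : 0 < |t₀| + 1 := by positivity
  obtain ⟨C, hC⟩ := hH.exists_le hT 0
  obtain ⟨M, hM0, hM⟩ := hH.exists_superlinear hT (|v₀| + 1) C
  have hsup := isCompact_Icc (a := -M) (b := M) |>.continuous_sSup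
    (f := fun (p : ℝ × ℝ × ℝ) (μ : ℝ) => p.2.1 * μ - H (clampArc ℓ p.1) (max 0 p.2.2) μ) hcont
  refine hsup.continuousAt.congr ?_
  have hnhds : {p : ℝ × ℝ × ℝ | |p.2.1| < |v₀| + 1 ∧ |p.2.2| < |t₀| + 1} ∈ 𝓝 (s₀, v₀, t₀) := by
    refine IsOpen.mem_nhds (IsOpen.inter (s := {p : ℝ × ℝ × ℝ | |p.2.1| < |v₀| + 1})
      (t := {p : ℝ × ℝ × ℝ | |p.2.2| < |t₀| + 1}) ?_ ?_) (by simp)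
    · exact isOpen_lt (by fun_prop) (by fun_prop)
    · exact isOpen_lt (by fun_prop) (by fun_prop)
  filter_upwards [hnhds] with p hp
  have hs := clampArc_mem hℓ p.1
  have ht : max 0 p.2.2 ∈ Icc 0 (|t₀| + 1) :=
    ⟨le_max_left _ _, max_le hT.le ((le_abs_self _).trans hp.2.le)⟩
  have h0 : (0 : ℝ) ∈ Icc (-M) M := by constructor <;> linarith
  have hbdd := hH.bddAbove hs ht.1 p.2.1
  refine le_antisymm ?_ ?_
  · refine csSup_le (Set.Nonempty.image _ ⟨0, h0⟩) ?_
    rintro _ ⟨μ, -, rfl⟩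
    exact hH.le_arcLagrangian hs ht.1 _ _
  · have hb : BddAbove ((fun μ : ℝ => p.2.1 * μ - H (clampArc ℓ p.1) (max 0 p.2.2) μ) ''
        Icc (-M) M) := hbdd.mono (image_subset_range _ _)
    refine ciSup_le fun μ => ?_
    rcases le_total M |μ| with h | h
    · refine le_csSup_of_le hb (mem_image_of_mem _ h0) ?_
      have h1 := hM _ hs _ ht μ h
      have h2 := hC _ hs _ ht 0 (by simp)
      have h3 : p.2.1 * μ ≤ |p.2.1| * |μ| := by rw [← abs_mul]; exact le_abs_self _
      have h4 : |p.2.1| * |μ| ≤ (|v₀| + 1) * |μ| := by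
        have := hp.1.le
        gcongr
      simp only [mul_zero, zero_sub]
      linarith
    · exact le_csSup hb (mem_image_of_mem _ (abs_le.1 h))

/-! ### Growth of subsolutions along segments. -/

theorem contDiff_one_intervalIntegral {f : ℝ → ℝ} (hf : Continuous f) (a : ℝ) :
    ContDiff ℝ 1 fun x => ∫ r in a..x, f r := by
  have h : ∀ x, HasDerivAt (fun x => ∫ r in a..x, f r) (f x) x := fun x =>
    intervalIntegral.integral_hasDerivAt_right (hf.intervalIntegrable _ _)
      hf.aestronglyMeasurable.stronglyMeasurableAtFilter hf.continuousAt
  rw [contDiff_one_iff_deriv]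
  refine ⟨fun x => (h x).differentiableAt, ?_⟩
  rwa [show deriv (fun x => ∫ r in a..x, f r) = f from funext fun x => (h x).deriv]

/-- Along a segment in the open strip, a continuous viscosity subsolution grows at most by the
action of the segment. -/
theorem IsViscositySubsolution.sub_le_integral_of_mem_Ioo {ℓ : ℝ} {H : ℝ → ℝ → ℝ → ℝ}
    {W : ℝ × ℝ → ℝ} (hsub : IsViscositySubsolution ℓ H W) (hℓ : 0 ≤ ℓ) (hH : IsArcHamiltonian ℓ H)
    (hW : ContinuousOn W (closedArcStrip ℓ)) {x v t₀ t₁ : ℝ} (ht₀ : 0 < t₀) (ht : t₀ ≤ t₁)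
    (hx₀ : x + v * t₀ ∈ Ioo 0 ℓ) (hx₁ : x + v * t₁ ∈ Ioo 0 ℓ) :
    W (x + v * t₁, t₁) - W (x + v * t₀, t₀) ≤
      ∫ τ in t₀..t₁, extLagrangian ℓ H (x + v * τ) v τ := by
  rcases ht.eq_or_lt with rfl | ht
  · simp
  have hLc := hH.continuous_extLagrangian hℓ
  have hLz : Continuous fun τ => extLagrangian ℓ H (x + v * τ) v τ :=
    hLc.comp (f := fun τ : ℝ => (x + v * τ, v, τ)) (by fun_prop)
  set I : ℝ → ℝ := fun t => ∫ τ in t₀..t, extLagrangian ℓ H (x + v * τ) v τ with hI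
  have hIder : ∀ t, HasDerivAt I (extLagrangian ℓ H (x + v * t) v t) t := fun t =>
    intervalIntegral.integral_hasDerivAt_right (hLz.intervalIntegrable _ _)
      hLz.aestronglyMeasurable.stronglyMeasurableAtFilter hLz.continuousAt
  have hIC : ContDiff ℝ 1 I := contDiff_one_intervalIntegral hLz t₀
  have hI0 : I t₀ = 0 := by simp [hI]
  by_contra! hcon
  change I t₁ < _ at hcon
  -- Prolonging the segment past `t₁` leaves room for a barrier, so that the maximum found below is
  -- not on the final time slice.
  obtain ⟨σ, hσ, hx₂⟩ : ∃ σ > 0, x + v * (t₁ + σ) ∈ Ioo 0 ℓ := by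
    have hc : Tendsto (fun σ : ℝ => x + v * (t₁ + σ)) (𝓝[>] 0) (𝓝 (x + v * t₁)) := by
      refine tendsto_nhdsWithin_of_tendsto_nhds ?_
      have : Continuous fun σ : ℝ => x + v * (t₁ + σ) := by fun_prop
      simpa using this.tendsto 0
    obtain ⟨σ, h1, h2⟩ := ((hc.eventually (Ioo_mem_nhds hx₁.1 hx₁.2)).and
      self_mem_nhdsWithin).exists
    exact ⟨σ, h2, h1⟩
  set t₂ := t₁ + σ with ht₂
  obtain ⟨d, hd, hdz⟩ : ∃ d > 0, ∀ τ ∈ Icc t₀ t₂, d ≤ x + v * τ ∧ x + v * τ ≤ ℓ - d := by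
    refine ⟨min (min (x + v * t₀) (x + v * t₂)) (min (ℓ - (x + v * t₀)) (ℓ - (x + v * t₂))),
      by simp only [lt_min_iff, gt_iff_lt]; exact ⟨⟨hx₀.1, hx₂.1⟩, by linarith [hx₀.2],
        by linarith [hx₂.2]⟩, fun τ hτ => ?_⟩
    set m := min (min (x + v * t₀) (x + v * t₂)) (min (ℓ - (x + v * t₀)) (ℓ - (x + v * t₂)))
    have h1 : m ≤ x + v * t₀ := (min_le_left _ _).trans (min_le_left _ _)
    have h2 : m ≤ x + v * t₂ := (min_le_left _ _).trans (min_le_right _ _)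
    have h3 : m ≤ ℓ - (x + v * t₀) := (min_le_right _ _).trans (min_le_left _ _)
    have h4 : m ≤ ℓ - (x + v * t₂) := (min_le_right _ _).trans (min_le_right _ _)
    rcases le_total 0 v with hv | hv
    · have := mul_le_mul_of_nonneg_left hτ.1 hv
      have := mul_le_mul_of_nonneg_left hτ.2 hv
      constructor <;> linarith
    · have := mul_le_mul_of_nonpos_left hτ.1 hv
      have := mul_le_mul_of_nonpos_left hτ.2 hv
      constructor <;> linarith
  obtain ⟨g, hg, hgap⟩ : ∃ g > 0, W (x + v * t₁, t₁) = W (x + v * t₀, t₀) + I t₁ + g :=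
    ⟨W (x + v * t₁, t₁) - W (x + v * t₀, t₀) - I t₁, by linarith, by ring⟩
  have h10 : 0 < t₁ - t₀ := by linarith
  -- The drift `δ` and the barrier `B` each cost `g / 4` at time `t₁`; the remaining `g / 2` is
  -- matched by the modulus `ρ₁` of `W`.
  set δ := g / 4 / (t₁ - t₀) with hδ
  have hδ0 : 0 < δ := by positivity
  have hδt : δ * (t₁ - t₀) = g / 4 := by rw [hδ]; field_simp
  set B := g / 4 with hB
  have hB0 : 0 < B := by positivity
  set K : Set (ℝ × ℝ) := Icc 0 ℓ ×ˢ Icc t₀ t₂ with hK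
  have hKc : IsCompact K := isCompact_Icc.prod isCompact_Icc
  have hKsub : K ⊆ closedArcStrip ℓ := prod_mono le_rfl fun τ hτ => ht₀.le.trans hτ.1
  have hWK : ContinuousOn W K := hW.mono hKsub
  set F : ℝ × ℝ → ℝ := fun p => W p - I p.2 - δ * (p.2 - t₀) with hF
  have hFK : ContinuousOn F K := by
    refine (hWK.sub ?_).sub (by fun_prop)
    exact (hIC.continuous.comp continuous_snd).continuousOn
  obtain ⟨M, hM⟩ := hKc.exists_bound_of_continuousOn hFK
  have ht₁K : (x + v * t₁, t₁) ∈ K :=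
    ⟨⟨hx₁.1.le, hx₁.2.le⟩, ht.le, by simp only [ht₂]; linarith⟩
  have ht₀K : (x + v * t₀, t₀) ∈ K :=
    ⟨⟨hx₀.1.le, hx₀.2.le⟩, le_rfl, by simp only [ht₂]; linarith⟩
  have hM0 : 0 ≤ M := (norm_nonneg _).trans (hM _ ht₁K)
  obtain ⟨ρ₁, hρ₁, hWu⟩ := Metric.uniformContinuousOn_iff.1
    (hKc.uniformContinuousOn_of_continuous hWK) (g / 2) (by positivity)
  have hLv : Continuous fun p : ℝ × ℝ => extLagrangian ℓ H p.1 v p.2 :=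
    hLc.comp (f := fun p : ℝ × ℝ => (p.1, v, p.2)) (by fun_prop)
  obtain ⟨ρ₂, hρ₂, hLu⟩ := Metric.uniformContinuousOn_iff.1
    (hKc.uniformContinuousOn_of_continuous hLv.continuousOn) δ hδ0
  set ρ := min d (min ρ₁ ρ₂) / 2 with hρ
  have hρ0 : 0 < ρ := by positivity
  have hρd : ρ < d := by
    have := min_le_left d (min ρ₁ ρ₂); simp only [hρ]; linarith
  have hρ1 : ρ < ρ₁ := by
    have := (min_le_right d (min ρ₁ ρ₂)).trans (min_le_left _ _); simp only [hρ]; linarith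
  have hρ2 : ρ < ρ₂ := by
    have := (min_le_right d (min ρ₁ ρ₂)).trans (min_le_right _ _); simp only [hρ]; linarith
  set q := (2 * M + B) / ρ ^ 2 with hq
  have hq0 : 0 < q := by positivity
  set N := (2 * M + B) / (B * σ) with hN
  have hN0 : 0 < N := by positivity
  -- The quadratic term keeps the maximum within `ρ` of the segment. The exponential equals `B` at
  -- `t₁` and exceeds `2 * M + B` at `t₂`, and its positive time derivative has the favourable sign.
  set ψ : ℝ × ℝ → ℝ := fun p => I p.2 + δ * (p.2 - t₀) + q * (p.1 - (x + v * p.2)) ^ 2 +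
    B * Real.exp (N * (p.2 - t₁)) with hψ
  have hψC : ContDiff ℝ 1 ψ := by
    have := hIC.comp (contDiff_snd (𝕜 := ℝ) (E := ℝ) (F := ℝ) (n := 1))
    refine ContDiff.add (ContDiff.add (ContDiff.add this ?_) ?_) ?_ <;> fun_prop
  obtain ⟨⟨s, τ⟩, hsτ, hmax⟩ := hKc.exists_isMaxOn ⟨_, ht₁K⟩
    (hWK.sub hψC.continuous.continuousOn)
  have hval := hmax ht₁K
  have hexp0 : 0 < B * Real.exp (N * (τ - t₁)) := by positivity
  have hFb := abs_le.1 (hM _ hsτ)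
  have hFb1 := abs_le.1 (hM _ ht₁K)
  simp only [hψ, hF, sub_self, mul_zero, Real.exp_zero, mul_one, ne_eq, OfNat.ofNat_ne_zero,
    not_false_eq_true, zero_pow, add_zero, mem_ofPred_eq, Pi.sub_apply] at hval hFb hFb1
  have hdist : |s - (x + v * τ)| ≤ ρ := by
    have h1 : q * (s - (x + v * τ)) ^ 2 ≤ q * ρ ^ 2 := by
      have : q * ρ ^ 2 = 2 * M + B := by rw [hq]; field_simp
      rw [this]; linarith
    exact abs_le_of_sq_le_sq (le_of_mul_le_mul_left h1 hq0) hρ0.le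
  have hsq : 0 ≤ q * (s - (x + v * τ)) ^ 2 := by positivity
  have hdist' := abs_le.1 hdist
  have hτ2 : τ ≠ t₂ := by
    intro hτ'
    have h1 : N * (τ - t₁) = (2 * M + B) / B := by
      rw [hN, hτ', ht₂]; field_simp; ring
    have h2 := Real.add_one_le_exp (N * (τ - t₁))
    have h3 : B * ((2 * M + B) / B + 1) ≤ B * Real.exp (N * (τ - t₁)) := by
      rw [h1] at h2 ⊢; gcongr
    have h4 : B * ((2 * M + B) / B + 1) = 2 * M + 2 * B := by field_simp; ring
    linarith
  -- At time `t₀` the value of `W - ψ` would be below `W (x + v * t₀, t₀) + g / 2`, which is its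
  -- value at `(x + v * t₁, t₁)`.
  have hτ0 : τ ≠ t₀ := by
    rintro rfl
    have h1 := hWu _ hsτ _ ht₀K (by
      rw [Prod.dist_eq, dist_self, max_eq_left dist_nonneg]; exact hdist.trans_lt hρ1)
    have h2 := (abs_lt.1 h1).2
    simp only [hI0, sub_self, mul_zero] at hval
    linarith
  have hτI : τ ∈ Ioo t₀ t₂ :=
    ⟨lt_of_le_of_ne hsτ.2.1 hτ0.symm, lt_of_le_of_ne hsτ.2.2 hτ2⟩
  have hdτ := hdz τ hsτ.2
  have hsI : s ∈ Ioo 0 ℓ := ⟨by linarith, by linarith⟩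
  have hKn : K ∈ 𝓝 (s, τ) := prod_mem_nhds (Icc_mem_nhds hsI.1 hsI.2) (Icc_mem_nhds hτI.1 hτI.2)
  have hvisc := hsub ψ hψC.contDiffOn s τ ⟨hsI, ht₀.trans hτI.1⟩ (hmax.isLocalMax hKn)
  have hd1 : HasDerivAt (fun r => ψ (s, r)) (extLagrangian ℓ H (x + v * τ) v τ + δ -
      v * (2 * q * (s - (x + v * τ))) + B * (Real.exp (N * (τ - t₁)) * N)) τ := by
    have h1 : HasDerivAt (fun r : ℝ => δ * (r - t₀)) δ τ := by
      simpa using ((hasDerivAt_id τ).sub_const t₀).const_mul δ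
    have h2 : HasDerivAt (fun r : ℝ => q * (s - (x + v * r)) ^ 2)
        (-(v * (2 * q * (s - (x + v * τ))))) τ := by
      have := ((((hasDerivAt_id τ).const_mul v).const_add x).const_sub s).pow 2 |>.const_mul q
      refine this.congr_deriv ?_
      simp; ring
    have h3 : HasDerivAt (fun r : ℝ => B * Real.exp (N * (r - t₁)))
        (B * (Real.exp (N * (τ - t₁)) * N)) τ := by
      have := (((hasDerivAt_id τ).sub_const t₁).const_mul N).exp.const_mul B
      simpa using this
    exact (((hIder τ).add h1).add h2).add h3
  have hd2 : HasDerivAt (fun r => ψ (r, τ)) (2 * q * (s - (x + v * τ))) s := by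
    have h2 := (((hasDerivAt_id s).sub_const (x + v * τ)).pow 2 |>.const_mul q).const_add
      (I τ + δ * (τ - t₀)) |>.add_const (B * Real.exp (N * (τ - t₁)))
    refine h2.congr_deriv ?_
    simp; ring
  rw [hd1.deriv, hd2.deriv] at hvisc
  -- With the momentum of the test function, Fenchel turns the viscosity inequality into `L` on the
  -- segment plus `δ` being less than `L` at `(s, τ)`, while the two values of `L` differ by less
  -- than `δ`.
  have hfen := hH.le_arcLagrangian hsτ.1 (ht₀.le.trans hτI.1.le) v (2 * q * (s - (x + v * τ)))
  rw [← extLagrangian_eq hsτ.1 (ht₀.le.trans hτI.1.le)] at hfen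
  have hLs := hLu _ hsτ (x + v * τ, τ) ⟨⟨by linarith, by linarith⟩, hsτ.2⟩ (by
      rw [Prod.dist_eq, dist_self, max_eq_left dist_nonneg]; exact hdist.trans_lt hρ2)
  have h2 := (abs_lt.1 hLs).2
  have h3 : 0 < B * (Real.exp (N * (τ - t₁)) * N) := by positivity
  simp only at h2
  linarith

/-- The continuous extension of a function on the closed strip by composition with retractions. -/
noncomputable def extStrip (ℓ : ℝ) (W : ℝ × ℝ → ℝ) (p : ℝ × ℝ) : ℝ :=
  W (clampArc ℓ p.1, max 0 p.2)

theorem extStrip_eq {ℓ : ℝ} {W : ℝ × ℝ → ℝ} {s t : ℝ} (hs : s ∈ Icc 0 ℓ) (ht : 0 ≤ t) :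
    extStrip ℓ W (s, t) = W (s, t) := by
  rw [extStrip, clampArc_of_mem hs, max_eq_right ht]

theorem continuous_extStrip {ℓ : ℝ} (hℓ : 0 ≤ ℓ) {W : ℝ × ℝ → ℝ}
    (hW : ContinuousOn W (closedArcStrip ℓ)) : Continuous (extStrip ℓ W) :=
  hW.comp_continuous (f := fun p : ℝ × ℝ => (clampArc ℓ p.1, max 0 p.2)) (by fun_prop)
    fun _ => ⟨clampArc_mem hℓ _, le_max_left (0 : ℝ) _⟩

theorem Continuous.extLagrangian_comp {X : Type*} [TopologicalSpace X] {ℓ : ℝ}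
    {H : ℝ → ℝ → ℝ → ℝ} (hH : IsArcHamiltonian ℓ H) (hℓ : 0 ≤ ℓ) {a b c : X → ℝ}
    (ha : Continuous a) (hb : Continuous b) (hc : Continuous c) :
    Continuous fun x => extLagrangian ℓ H (a x) (b x) (c x) :=
  (hH.continuous_extLagrangian hℓ).comp (ha.prodMk (hb.prodMk hc))

theorem segment_mem_Icc {ℓ x v t₁ t₂ : ℝ} (hx₁ : x + v * t₁ ∈ Icc 0 ℓ) (hx₂ : x + v * t₂ ∈ Icc 0 ℓ) :
    ∀ τ ∈ Icc t₁ t₂, x + v * τ ∈ Icc 0 ℓ := fun τ hτ => by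
  rcases le_total 0 v with hv | hv
  · have := mul_le_mul_of_nonneg_left hτ.1 hv
    have := mul_le_mul_of_nonneg_left hτ.2 hv
    constructor <;> linarith [hx₁.1, hx₂.2]
  · have := mul_le_mul_of_nonpos_left hτ.1 hv
    have := mul_le_mul_of_nonpos_left hτ.2 hv
    constructor <;> linarith [hx₂.1, hx₁.2]

theorem ae_ne_real (c : ℝ) : ∀ᵐ τ : ℝ, τ ≠ c := by simp [ae_iff]

theorem HasDerivAt.nonneg_of_nonneg_right {k : ℝ → ℝ} {k' τ : ℝ} (hk : HasDerivAt k k' τ)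
    (h0 : k τ = 0) (hpos : ∀ᶠ b in 𝓝[>] τ, 0 ≤ k b) : 0 ≤ k' := by
  have h := (hasDerivAt_iff_tendsto_slope.1 hk).mono_left
    (nhdsWithin_mono τ (fun b (hb : b ∈ Ioi τ) => ne_of_gt hb))
  refine ge_of_tendsto h ?_
  filter_upwards [hpos, self_mem_nhdsWithin] with b hb hτb
  rw [slope_def_field, h0, sub_zero]
  exact div_nonneg hb (sub_nonneg.2 (le_of_lt hτb))

theorem HasDerivAt.abs_of_eq_zero {f : ℝ → ℝ} {τ : ℝ} (hf : HasDerivAt f 0 τ) (h0 : f τ = 0) :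
    HasDerivAt (fun b => |f b|) 0 τ := by
  rw [hasDerivAt_iff_isLittleO] at hf ⊢
  simp only [h0, sub_zero, smul_zero, abs_zero] at hf ⊢
  exact hf.abs_left

/-- Along a segment in the closed strip, a continuous viscosity subsolution grows at most by the
action of the segment. -/
theorem IsViscositySubsolution.sub_le_integral_segment {ℓ : ℝ} {H : ℝ → ℝ → ℝ → ℝ}
    {W : ℝ × ℝ → ℝ} (hsub : IsViscositySubsolution ℓ H W) (hℓ : 0 < ℓ) (hH : IsArcHamiltonian ℓ H)
    (hW : ContinuousOn W (closedArcStrip ℓ)) {x v t₀ t₁ : ℝ} (ht₀ : 0 ≤ t₀) (ht : t₀ ≤ t₁)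
    (hx₀ : x + v * t₀ ∈ Icc 0 ℓ) (hx₁ : x + v * t₁ ∈ Icc 0 ℓ) :
    W (x + v * t₁, t₁) - W (x + v * t₀, t₀) ≤
      ∫ τ in t₀..t₁, extLagrangian ℓ H (x + v * τ) v τ := by
  have hWc := continuous_extStrip hℓ.le hW
  -- For `θ ∈ (0, 1)`, moving the segment towards the midpoint `ℓ / 2` and delaying it by `θ` puts
  -- it in the open strip at positive times; both sides are continuous in `θ`.
  set l : ℝ → ℝ := fun θ =>
    extStrip ℓ W ((1 - θ) * (x + v * t₁) + θ * (ℓ / 2), t₁ + θ) -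
      extStrip ℓ W ((1 - θ) * (x + v * t₀) + θ * (ℓ / 2), t₀ + θ) with hl
  set r : ℝ → ℝ := fun θ => ∫ τ in t₀..t₁,
    extLagrangian ℓ H ((1 - θ) * (x + v * τ) + θ * (ℓ / 2)) ((1 - θ) * v) (τ + θ) with hr
  have hlc : Continuous l := by fun_prop
  have hrc : Continuous r := by
    refine intervalIntegral.continuous_parametric_intervalIntegral_of_continuous' ?_ _ _
    exact Continuous.extLagrangian_comp hH hℓ.le (by fun_prop) (by fun_prop) (by fun_prop)
  have hlim : l 0 ≤ r 0 := by
    refine le_of_tendsto_of_tendsto (hlc.tendsto 0 |>.mono_left nhdsWithin_le_nhds)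
      (hrc.tendsto 0 |>.mono_left nhdsWithin_le_nhds) (b := 𝓝[>] 0) ?_
    filter_upwards [Ioo_mem_nhdsGT (zero_lt_one' ℝ)] with θ hθ
    have key : ∀ y ∈ Icc 0 ℓ, (1 - θ) * y + θ * (ℓ / 2) ∈ Ioo 0 ℓ := by
      rintro y ⟨h0, h1⟩
      have h2 : 0 < 1 - θ := by linarith [hθ.2]
      have h3 := mul_nonneg h2.le h0
      have h4 := mul_le_mul_of_nonneg_left h1 h2.le
      have h5 := mul_pos hθ.1 hℓ
      constructor <;> linarith
    have e : ∀ τ, (1 - θ) * (x + v * τ) + θ * (ℓ / 2) =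
        ((1 - θ) * (x - v * θ) + θ * (ℓ / 2)) + (1 - θ) * v * (τ + θ) := fun τ => by ring
    have k₀ := key _ hx₀
    have k₁ := key _ hx₁
    have := hsub.sub_le_integral_of_mem_Ioo hℓ.le hH hW
      (x := (1 - θ) * (x - v * θ) + θ * (ℓ / 2)) (v := (1 - θ) * v) (t₀ := t₀ + θ) (t₁ := t₁ + θ)
      (by linarith [hθ.1]) (by linarith) (by rw [← e]; exact k₀) (by rw [← e]; exact k₁)
    rw [← intervalIntegral.integral_comp_add_right (fun τ => extLagrangian ℓ H
      ((1 - θ) * (x - v * θ) + θ * (ℓ / 2) + (1 - θ) * v * τ) ((1 - θ) * v) τ)] at this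
    simp only [← e] at this
    simp only [hl, hr]
    rwa [extStrip_eq (Ioo_subset_Icc_self k₀) (by linarith [hθ.1]),
      extStrip_eq (Ioo_subset_Icc_self k₁) (by linarith [hθ.1])]
  simp only [hl, hr, sub_zero, one_mul, zero_mul, add_zero] at hlim
  rwa [extStrip_eq hx₀ ht₀, extStrip_eq hx₁ (ht₀.trans ht)] at hlim

/-! ### Growth of subsolutions along absolutely continuous curves. -/

theorem AbsolutelyContinuousOnInterval.comp_lipschitz {V : ℝ × ℝ → ℝ} {η : ℝ → ℝ} {S : Set ℝ}
    {a b C : ℝ} (hη : AbsolutelyContinuousOnInterval η a b) (hηS : ∀ τ ∈ uIcc a b, η τ ∈ S)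
    (hV : ∀ s ∈ S, ∀ s' ∈ S, ∀ t ∈ uIcc a b, ∀ t' ∈ uIcc a b,
      |V (s, t) - V (s', t')| ≤ C * (|s - s'| + |t - t'|)) :
    AbsolutelyContinuousOnInterval (fun τ => V (η τ, τ)) a b := by
  have hid : AbsolutelyContinuousOnInterval (fun τ : ℝ => τ) a b :=
    (LipschitzWith.id.lipschitzOnWith (s := uIcc a b)).absolutelyContinuousOnInterval
  have hlim := (Tendsto.add hη hid).const_mul C
  simp only [add_zero, mul_zero] at hlim
  refine squeeze_zero' (Eventually.of_forall fun E => Finset.sum_nonneg fun i _ => dist_nonneg)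
    ?_ hlim
  filter_upwards [mem_inf_of_right (mem_principal_self _)] with E hE
  rw [← Finset.sum_add_distrib, Finset.mul_sum]
  refine Finset.sum_le_sum fun i hi => ?_
  obtain ⟨h1, h2⟩ := hE.1 i hi
  simpa only [Real.dist_eq] using hV _ (hηS _ h1) _ (hηS _ h2) _ h1 _ h2

/-- The derivative along a curve of a Lipschitz function that satisfies an action inequality on
segments. -/
theorem deriv_le_of_segment_inequality {V : ℝ × ℝ → ℝ} {Λ : ℝ → ℝ → ℝ → ℝ} {η : ℝ → ℝ}
    {ℓ a b C v g' τ : ℝ}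
    (hΛ : Continuous fun p : ℝ × ℝ × ℝ => Λ p.1 p.2.1 p.2.2)
    (hηS : ∀ τ ∈ Icc a b, η τ ∈ Icc 0 ℓ)
    (hV : ∀ s ∈ Icc 0 ℓ, ∀ s' ∈ Icc 0 ℓ, ∀ t ∈ Icc a b, ∀ t' ∈ Icc a b,
      |V (s, t) - V (s', t')| ≤ C * (|s - s'| + |t - t'|))
    (hseg : ∀ x v t₀ t₁ : ℝ, a ≤ t₀ → t₀ ≤ t₁ → t₁ ≤ b → x + v * t₀ ∈ Icc 0 ℓ →
      x + v * t₁ ∈ Icc 0 ℓ →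
      V (x + v * t₁, t₁) - V (x + v * t₀, t₀) ≤ ∫ τ in t₀..t₁, Λ (x + v * τ) v τ)
    (hτ : τ ∈ Ioo a b) (hη : HasDerivAt η v τ) (hg : HasDerivAt (fun τ => V (η τ, τ)) g' τ) :
    g' ≤ Λ (η τ) v τ := by
  have hnear : ∀ᶠ r in 𝓝 τ, r ∈ Icc a b := Icc_mem_nhds hτ.1 hτ.2
  have hητ := hηS τ (Ioo_subset_Icc_self hτ)
  set x := η τ - v * τ with hx
  -- The tangent line must stay in `[0, ℓ]`. If `η τ` is an endpoint, `η` has a local extremum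
  -- there, so `v = 0` and the tangent line is constant.
  have hin : ∀ᶠ r in 𝓝 τ, x + v * r ∈ Icc 0 ℓ := by
    have hc : Tendsto (fun r => x + v * r) (𝓝 τ) (𝓝 (η τ)) := by
      have : Continuous fun r => x + v * r := by fun_prop
      simpa [hx] using this.tendsto τ
    rcases hητ.1.eq_or_lt with h0 | h0
    · have hv : v = 0 := by
        refine IsLocalMin.hasDerivAt_eq_zero (f := η) ?_ hη
        filter_upwards [hnear] with r hr
        rw [← h0]; exact (hηS r hr).1
      simp only [hx, hv, zero_mul, sub_zero, add_zero]
      exact Eventually.of_forall fun _ => hητ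
    rcases hητ.2.eq_or_lt with h1 | h1
    · have hv : v = 0 := by
        refine IsLocalMax.hasDerivAt_eq_zero (f := η) ?_ hη
        filter_upwards [hnear] with r hr
        rw [h1]; exact (hηS r hr).2
      simp only [hx, hv, zero_mul, sub_zero, add_zero]
      exact Eventually.of_forall fun _ => hητ
    · exact hc.eventually (Icc_mem_nhds h0 h1)
  have hΛc : Continuous fun r => Λ (x + v * r) v r :=
    hΛ.comp (f := fun r : ℝ => (x + v * r, v, r)) (by fun_prop)
  have hI : HasDerivAt (fun r => ∫ σ in τ..r, Λ (x + v * σ) v σ) (Λ (x + v * τ) v τ) τ :=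
    intervalIntegral.integral_hasDerivAt_right (hΛc.intervalIntegrable _ _)
      hΛc.aestronglyMeasurable.stronglyMeasurableAtFilter hΛc.continuousAt
  have hrem : HasDerivAt (fun r => |η r - (x + v * r)|) 0 τ := by
    refine HasDerivAt.abs_of_eq_zero ?_ (by simp [hx])
    have := hη.sub (((hasDerivAt_id τ).const_mul v).const_add x)
    simpa using! this
  -- This function vanishes at `τ` and is nonnegative to the right: the segment inequality holds on
  -- the tangent line, and the Lipschitz bound pays for the distance to the curve, which is of order
  -- `o(r - τ)`.
  have hk := (hI.add (hrem.const_mul C)).sub (hg.sub_const (V (η τ, τ)))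
  have hxτ : x + v * τ = η τ := by simp [hx]
  have := hk.nonneg_of_nonneg_right (by simp [hxτ]) (by
    filter_upwards [self_mem_nhdsWithin, nhdsWithin_le_nhds hnear, nhdsWithin_le_nhds hin]
      with r hr hr1 hr2
    have h1 := hseg x v τ r hτ.1.le (le_of_lt hr) hr1.2 (by rwa [hxτ]) hr2
    have h2 := le_of_abs_le (hV _ (hηS r hr1) _ hr2 r hr1 r hr1)
    rw [hxτ] at h1
    simp only [sub_self, abs_zero, add_zero] at h2
    simp only [Pi.add_apply, Pi.sub_apply]
    linarith)
  rw [hxτ] at this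
  linarith

/-- The integral of a function on the strip over the time window `[t, t + h]`. -/
noncomputable def timeWindowIntegral (ℓ : ℝ) (W : ℝ × ℝ → ℝ) (h : ℝ) (p : ℝ × ℝ) : ℝ :=
  ∫ r in (0 : ℝ)..h, extStrip ℓ W (p.1, p.2 + r)

/-- Apply the segment inequality to the segment delayed by each `r ∈ [0, h]`, return the Lagrangian
to the original time at cost `K * (1 + |v|) * r`, and integrate over `r`. -/
theorem IsViscositySubsolution.timeWindowIntegral_sub_le {ℓ : ℝ} {H : ℝ → ℝ → ℝ → ℝ}
    {W : ℝ × ℝ → ℝ} (hsub : IsViscositySubsolution ℓ H W) (hℓ : 0 < ℓ) (hH : IsArcHamiltonian ℓ H)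
    (hW : ContinuousOn W (closedArcStrip ℓ)) {T K h : ℝ} (hK : 0 ≤ K) (h0 : 0 ≤ h)
    (hlip : ∀ s ∈ Icc 0 ℓ, ∀ t ∈ Icc 0 T, ∀ r ∈ Icc 0 h, ∀ v : ℝ,
      arcLagrangian H s v (t + r) ≤ arcLagrangian H s v t + K * (1 + |v|) * r)
    {x v t₀ t₁ : ℝ} (ht₀ : 0 ≤ t₀) (ht : t₀ ≤ t₁) (ht₁ : t₁ ≤ T)
    (hx₀ : x + v * t₀ ∈ Icc 0 ℓ) (hx₁ : x + v * t₁ ∈ Icc 0 ℓ) :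
    timeWindowIntegral ℓ W h (x + v * t₁, t₁) - timeWindowIntegral ℓ W h (x + v * t₀, t₀) ≤
      ∫ τ in t₀..t₁, h * (extLagrangian ℓ H (x + v * τ) v τ + K * (1 + |v|) * h) := by
  have hWc := continuous_extStrip hℓ.le hW
  have hc : ∀ s t : ℝ, Continuous fun r => extStrip ℓ W (s, t + r) := fun s t => by fun_prop
  have hxτ := segment_mem_Icc hx₀ hx₁
  simp only [timeWindowIntegral]
  rw [← intervalIntegral.integral_sub ((hc _ _).intervalIntegrable _ _)
    ((hc _ _).intervalIntegrable _ _), intervalIntegral.integral_const_mul]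
  have hpt : ∀ r ∈ Icc 0 h, extStrip ℓ W (x + v * t₁, t₁ + r) - extStrip ℓ W (x + v * t₀, t₀ + r) ≤
      ∫ τ in t₀..t₁, (extLagrangian ℓ H (x + v * τ) v τ + K * (1 + |v|) * h) := by
    intro r hr
    have e : ∀ τ, (x - v * r) + v * (τ + r) = x + v * τ := fun τ => by ring
    have h1 := hsub.sub_le_integral_segment hℓ hH hW (x := x - v * r) (v := v) (t₀ := t₀ + r)
      (t₁ := t₁ + r) (by linarith [hr.1]) (by linarith) (by rwa [e]) (by rwa [e])
    rw [← intervalIntegral.integral_comp_add_right (fun τ => extLagrangian ℓ H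
      (x - v * r + v * τ) v τ)] at h1
    simp only [e] at h1
    rw [extStrip_eq hx₁ (by linarith [hr.1]), extStrip_eq hx₀ (by linarith [hr.1])]
    refine h1.trans (intervalIntegral.integral_mono_on ht ?_ ?_ fun τ hτ => ?_)
    · exact (Continuous.extLagrangian_comp hH hℓ.le (by fun_prop) (by fun_prop)
        (by fun_prop)).intervalIntegrable _ _
    · exact ((Continuous.extLagrangian_comp hH hℓ.le (by fun_prop) (by fun_prop)
        (by fun_prop)).add continuous_const).intervalIntegrable _ _
    · have hτ0 : 0 ≤ τ := ht₀.trans hτ.1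
      rw [extLagrangian_eq (hxτ τ hτ) (by linarith [hr.1]), extLagrangian_eq (hxτ τ hτ) hτ0]
      have h2 := hlip _ (hxτ τ hτ) τ ⟨hτ0, hτ.2.trans ht₁⟩ r hr v
      have h3 : K * (1 + |v|) * r ≤ K * (1 + |v|) * h := by
        have := hr.2
        gcongr
      linarith
  have h2 := intervalIntegral.integral_mono_on (μ := volume) h0
    (((hc _ _).sub (hc _ _)).intervalIntegrable _ _)
    ((continuous_const (X := ℝ)).intervalIntegrable (μ := volume) _ _) hpt
  simpa using h2

/-- Two time windows differ by two intervals of length `|t - t'|`, so boundedness of `W` suffices.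
-/
theorem abs_timeWindowIntegral_sub_le {ℓ : ℝ} (hℓ : 0 ≤ ℓ) {W : ℝ × ℝ → ℝ}
    (hW : ContinuousOn W (closedArcStrip ℓ)) {T M h : ℝ} (h0 : 0 ≤ h)
    (hM : ∀ s ∈ Icc 0 ℓ, ∀ t ∈ Icc 0 (T + h), |W (s, t)| ≤ M) {s t t' : ℝ} (hs : s ∈ Icc 0 ℓ)
    (ht : t ∈ Icc 0 T) (ht' : t' ∈ Icc 0 T) :
    |timeWindowIntegral ℓ W h (s, t) - timeWindowIntegral ℓ W h (s, t')| ≤ 2 * M * |t - t'| := by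
  have hc : Continuous fun r => extStrip ℓ W (s, r) := by
    have := continuous_extStrip hℓ hW
    fun_prop
  have e : ∀ t, timeWindowIntegral ℓ W h (s, t) = ∫ r in t..(t + h), extStrip ℓ W (s, r) := by
    intro t
    simp only [timeWindowIntegral]
    rw [intervalIntegral.integral_comp_add_left (fun r => extStrip ℓ W (s, r)), add_zero]
  have hb : ∀ a ∈ Icc 0 (T + h), ∀ b ∈ Icc 0 (T + h),
      |∫ r in a..b, extStrip ℓ W (s, r)| ≤ M * |b - a| := by
    intro a ha b hb
    rw [← Real.norm_eq_abs]
    refine intervalIntegral.norm_integral_le_of_norm_le_const fun r hr => ?_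
    have hr' := uIoc_subset_uIcc.trans (uIcc_subset_Icc ha hb) hr
    rw [extStrip_eq hs hr'.1]
    exact hM s hs r hr'
  rw [e, e, intervalIntegral.integral_interval_sub_interval_comm (hc.intervalIntegrable _ _)
    (hc.intervalIntegrable _ _) (hc.intervalIntegrable _ _)]
  have h1 := hb t ⟨ht.1, by linarith [ht.2]⟩ t' ⟨ht'.1, by linarith [ht'.2]⟩
  have h2 := hb (t + h) ⟨by linarith [ht.1], by linarith [ht.2]⟩ (t' + h)
    ⟨by linarith [ht'.1], by linarith [ht'.2]⟩
  rw [abs_sub_comm] at h1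
  rw [show t' + h - (t + h) = t' - t by ring, abs_sub_comm] at h2
  have h3 := abs_sub (∫ r in t..t', extStrip ℓ W (s, r))
    (∫ r in (t + h)..(t' + h), extStrip ℓ W (s, r))
  linarith

/-- A continuous viscosity subsolution, averaged over a short time window, is Lipschitz. -/
theorem IsViscositySubsolution.exists_lipschitz_timeWindowIntegral {ℓ : ℝ} {H : ℝ → ℝ → ℝ → ℝ}
    {W : ℝ × ℝ → ℝ} (hsub : IsViscositySubsolution ℓ H W) (hℓ : 0 < ℓ) (hH : IsArcHamiltonian ℓ H)
    (hW : ContinuousOn W (closedArcStrip ℓ)) {T K h : ℝ} (hK : 0 ≤ K) (h0 : 0 ≤ h)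
    (hlip : ∀ s ∈ Icc 0 ℓ, ∀ t ∈ Icc 0 (T + ℓ), ∀ r ∈ Icc 0 h, ∀ v : ℝ,
      arcLagrangian H s v (t + r) ≤ arcLagrangian H s v t + K * (1 + |v|) * r) :
    ∃ C : ℝ, ∀ s ∈ Icc 0 ℓ, ∀ s' ∈ Icc 0 ℓ, ∀ t ∈ Icc 0 T, ∀ t' ∈ Icc 0 T,
      |timeWindowIntegral ℓ W h (s, t) - timeWindowIntegral ℓ W h (s', t')| ≤
        C * (|s - s'| + |t - t'|) := by
  obtain ⟨M, hM⟩ := (isCompact_Icc (a := 0) (b := ℓ) |>.prod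
    (isCompact_Icc (a := 0) (b := T + ℓ + h))).exists_bound_of_continuousOn
    (hW.mono (prod_mono le_rfl Icc_subset_Ici_self))
  have hM' : ∀ s ∈ Icc 0 ℓ, ∀ t ∈ Icc 0 (T + ℓ + h), |W (s, t)| ≤ M := fun s hs t ht =>
    hM (s, t) ⟨hs, ht⟩
  have hLc : Continuous fun p : ℝ × ℝ × ℝ =>
      h * (extLagrangian ℓ H p.1 p.2.1 p.2.2 + K * (1 + |p.2.1|) * h) := by
    have := hH.continuous_extLagrangian hℓ.le
    fun_prop
  obtain ⟨N, hN⟩ := (isCompact_Icc (a := 0) (b := ℓ) |>.prod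
    ((isCompact_Icc (a := -1) (b := 1)).prod
    (isCompact_Icc (a := 0) (b := T + ℓ)))).exists_bound_of_continuousOn hLc.continuousOn
  have htime := fun {s t t' : ℝ} => abs_timeWindowIntegral_sub_le (s := s) (t := t) (t' := t')
    hℓ.le hW h0 hM'
  -- Travel from `s` to `s'` at unit speed, which takes time `|s - s'| ≤ ℓ`, then undo the delay
  -- with the Lipschitz bound in time. This is why the time horizon is `T + ℓ`.
  have hspace : ∀ s ∈ Icc 0 ℓ, ∀ s' ∈ Icc 0 ℓ, ∀ t ∈ Icc 0 T,
      timeWindowIntegral ℓ W h (s', t) - timeWindowIntegral ℓ W h (s, t) ≤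
        (N + 2 * M) * |s - s'| := by
    intro s hs s' hs' t ht
    obtain ⟨v, hv, hvs⟩ : ∃ v ∈ Icc (-1 : ℝ) 1, s' = s + v * |s - s'| := by
      rcases le_total s s' with hss | hss
      · exact ⟨1, by simp, by rw [abs_of_nonpos (by linarith)]; ring⟩
      · exact ⟨-1, by simp, by rw [abs_of_nonneg (by linarith)]; ring⟩
    set d := |s - s'| with hd
    have hd0 : 0 ≤ d := abs_nonneg _
    have hdℓ : d ≤ ℓ := abs_le.2 ⟨by linarith [hs.1, hs'.2], by linarith [hs.2, hs'.1]⟩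
    have e1 : s - v * t + v * t = s := by ring
    have e2 : s - v * t + v * (t + d) = s' := by rw [hvs]; ring
    have h1 := hsub.timeWindowIntegral_sub_le hℓ hH hW hK h0 hlip (x := s - v * t) (v := v)
      (t₀ := t) (t₁ := t + d) ht.1 (by linarith) (by linarith [ht.2]) (by rwa [e1])
      (by rwa [e2])
    rw [e1, e2] at h1
    have h2 : ‖∫ τ in t..(t + d), h * (extLagrangian ℓ H (s - v * t + v * τ) v τ +
        K * (1 + |v|) * h)‖ ≤ N * |t + d - t| := by
      refine intervalIntegral.norm_integral_le_of_norm_le_const fun r hr => ?_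
      rw [uIoc_of_le (by linarith)] at hr
      refine hN (s - v * t + v * r, v, r) ⟨?_, hv, ht.1.trans hr.1.le, by linarith [hr.2, ht.2]⟩
      have h3 : s - v * t + v * r = s + v * (r - t) := by ring
      rw [h3]
      have h4 : 0 ≤ r - t := by linarith [hr.1]
      have h5 : r - t ≤ d := by linarith [hr.2]
      rcases le_total 0 v with hv0 | hv0
      · have := mul_nonneg hv0 h4
        have := mul_le_mul_of_nonneg_left h5 hv0
        constructor <;> linarith [hs.1, hs'.2]
      · have := mul_nonpos_of_nonpos_of_nonneg hv0 h4
        have := mul_le_mul_of_nonpos_left h5 hv0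
        constructor <;> linarith [hs.2, hs'.1]
    rw [add_sub_cancel_left, abs_of_nonneg hd0] at h2
    have h3 := htime (s := s') (t := t) (t' := t + d) hs' ⟨ht.1, by linarith [ht.2]⟩
      ⟨by linarith [ht.1], by linarith [ht.2]⟩
    rw [show t - (t + d) = -d by ring, abs_neg, abs_of_nonneg hd0] at h3
    have h4 := le_of_abs_le h3
    have h5 := le_of_abs_le (Real.norm_eq_abs _ ▸ h2)
    linarith
  refine ⟨max (N + 2 * M) (2 * M), fun s hs s' hs' t ht t' ht' => ?_⟩
  have h1 : |timeWindowIntegral ℓ W h (s, t) - timeWindowIntegral ℓ W h (s', t)| ≤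
      (N + 2 * M) * |s - s'| := by
    refine abs_sub_le_iff.2 ⟨?_, hspace s hs s' hs' t ht⟩
    rw [abs_sub_comm]
    exact hspace s' hs' s hs t ht
  have h2 := htime (s := s') (t := t) (t' := t') hs' ⟨ht.1, by linarith [ht.2]⟩
    ⟨ht'.1, by linarith [ht'.2]⟩
  have h3 := abs_sub_le (timeWindowIntegral ℓ W h (s, t)) (timeWindowIntegral ℓ W h (s', t))
    (timeWindowIntegral ℓ W h (s', t'))
  have h4 := mul_le_mul_of_nonneg_right (le_max_left (N + 2 * M) (2 * M)) (abs_nonneg (s - s'))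
  have h5 := mul_le_mul_of_nonneg_right (le_max_right (N + 2 * M) (2 * M)) (abs_nonneg (t - t'))
  linarith

/-- A continuous viscosity subsolution grows along an absolutely continuous curve at most by the
action of the curve. -/
theorem IsViscositySubsolution.sub_le_action {ℓ : ℝ} {H : ℝ → ℝ → ℝ → ℝ}
    {W : ℝ × ℝ → ℝ} (hsub : IsViscositySubsolution ℓ H W) (hℓ : 0 < ℓ) (hH : IsArcHamiltonian ℓ H)
    (hW : ContinuousOn W (closedArcStrip ℓ)) {η : ℝ → ℝ} {t₀ t₁ : ℝ} (ht₀ : 0 ≤ t₀)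
    (ht : t₀ ≤ t₁) (hη : AbsolutelyContinuousOnInterval η t₀ t₁)
    (hηS : ∀ τ ∈ Icc t₀ t₁, η τ ∈ Icc 0 ℓ)
    (hint : IntervalIntegrable (fun τ => arcLagrangian H (η τ) (deriv η τ) τ) volume t₀ t₁) :
    W (η t₁, t₁) - W (η t₀, t₀) ≤ ∫ τ in t₀..t₁, arcLagrangian H (η τ) (deriv η τ) τ := by
  have ht₁ : 0 ≤ t₁ := ht₀.trans ht
  obtain ⟨K, ε, hK, hε, hlip⟩ := hH.exists_arcLagrangian_time_lipschitz
    (T := t₁ + ℓ + 1) (by linarith)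
  set A := ∫ τ in t₀..t₁, arcLagrangian H (η τ) (deriv η τ) τ with hA
  set S := ∫ τ in t₀..t₁, (1 + |deriv η τ|) with hS
  have hder : IntervalIntegrable (fun τ => 1 + |deriv η τ|) volume t₀ t₁ :=
    intervalIntegrable_const.add hη.intervalIntegrable_deriv.abs
  have hmain : ∀ h ∈ Ioo 0 (min ε 1), timeWindowIntegral ℓ W h (η t₁, t₁) -
      timeWindowIntegral ℓ W h (η t₀, t₀) ≤ h * (A + K * h * S) := by
    intro h hh
    have h0 := hh.1.le
    have hhε := hh.2.trans_le (min_le_left _ _)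
    have hh1 := hh.2.trans_le (min_le_right _ _)
    have hlip' : ∀ s ∈ Icc 0 ℓ, ∀ t ∈ Icc 0 (t₁ + ℓ), ∀ r ∈ Icc 0 h, ∀ v : ℝ,
        arcLagrangian H s v (t + r) ≤ arcLagrangian H s v t + K * (1 + |v|) * r := by
      intro s hs t ht r hr v
      have := hlip s hs t ⟨ht.1, by linarith [ht.2]⟩ (t + r)
        ⟨by linarith [ht.1, hr.1], by linarith [ht.2, hr.2]⟩
        (by rw [add_sub_cancel_left, abs_of_nonneg hr.1]; linarith [hr.2]) v
      rwa [add_sub_cancel_left, abs_of_nonneg hr.1] at this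
    obtain ⟨C, hC⟩ := hsub.exists_lipschitz_timeWindowIntegral hℓ hH hW hK h0 hlip'
    have hsubset : Icc t₀ t₁ ⊆ Icc 0 t₁ := Icc_subset_Icc_left ht₀
    have hC' : ∀ s ∈ Icc 0 ℓ, ∀ s' ∈ Icc 0 ℓ, ∀ t ∈ Icc t₀ t₁, ∀ t' ∈ Icc t₀ t₁,
        |timeWindowIntegral ℓ W h (s, t) - timeWindowIntegral ℓ W h (s', t')| ≤
        C * (|s - s'| + |t - t'|) := fun s hs s' hs' t ht t' ht' =>
      hC s hs s' hs' t (hsubset ht) t' (hsubset ht')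
    have hgAC : AbsolutelyContinuousOnInterval
        (fun τ => timeWindowIntegral ℓ W h (η τ, τ)) t₀ t₁ := by
      refine hη.comp_lipschitz (S := Icc 0 ℓ) (C := C) ?_ ?_ <;> rwa [uIcc_of_le ht]
    rw [← hgAC.integral_deriv_eq_sub, hA, hS, ← intervalIntegral.integral_const_mul,
      ← intervalIntegral.integral_add hint (hder.const_mul _),
      ← intervalIntegral.integral_const_mul]
    refine intervalIntegral.integral_mono_ae_restrict ht hgAC.intervalIntegrable_deriv
      ((hint.add (hder.const_mul _)).const_mul _) ?_
    rw [EventuallyLE, ae_restrict_iff' measurableSet_Icc]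
    filter_upwards [hη.ae_differentiableAt, hgAC.ae_differentiableAt, ae_ne_real t₀,
      ae_ne_real t₁] with τ h1 h2 h3 h4 hτ
    rw [uIcc_of_le ht] at h1 h2
    have hτI : τ ∈ Ioo t₀ t₁ := ⟨lt_of_le_of_ne hτ.1 h3.symm, lt_of_le_of_ne hτ.2 h4⟩
    have := deriv_le_of_segment_inequality (V := timeWindowIntegral ℓ W h)
      (Λ := fun s v t => h * (extLagrangian ℓ H s v t + K * (1 + |v|) * h)) (by
        have := hH.continuous_extLagrangian hℓ.le
        fun_prop) hηS hC' (fun x v a b ha hab hb hxa hxb =>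
        hsub.timeWindowIntegral_sub_le hℓ hH hW hK h0 hlip' (ht₀.trans ha) hab (by linarith)
          hxa hxb) hτI (h1 hτ).hasDerivAt (h2 hτ).hasDerivAt
    rw [extLagrangian_eq (hηS τ hτ) (ht₀.trans hτ.1)] at this
    refine this.trans_eq ?_
    ring
  have hWc := continuous_extStrip hℓ.le hW
  set f : ℝ → ℝ := fun r => extStrip ℓ W (η t₁, t₁ + r) - extStrip ℓ W (η t₀, t₀ + r) with hf
  have hc : ∀ s t : ℝ, Continuous fun r => extStrip ℓ W (s, t + r) := fun s t => by fun_prop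
  have hfc : Continuous f := (hc _ _).sub (hc _ _)
  have hI : HasDerivAt (fun h => ∫ r in (0 : ℝ)..h, f r) (f 0) 0 :=
    intervalIntegral.integral_hasDerivAt_right (hfc.intervalIntegrable _ _)
      hfc.aestronglyMeasurable.stronglyMeasurableAtFilter hfc.continuousAt
  have hR : HasDerivAt (fun h : ℝ => h * (A + K * h * S)) A 0 := by
    have := (hasDerivAt_id (0 : ℝ)).mul
      ((((hasDerivAt_id (0 : ℝ)).const_mul K).mul_const S).const_add A)
    simpa using! this
  -- Both sides of `hmain` vanish at `h = 0`; comparing right derivatives there removes the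
  -- averaging and the error term.
  have hfin := (hR.sub hI).nonneg_of_nonneg_right (by simp) (by
    filter_upwards [Ioo_mem_nhdsGT (show 0 < min ε 1 by positivity)] with h hh
    have h1 := hmain h hh
    simp only [timeWindowIntegral] at h1
    rw [← intervalIntegral.integral_sub ((hc _ _).intervalIntegrable _ _)
      ((hc _ _).intervalIntegrable _ _)] at h1
    simp only [Pi.sub_apply]
    linarith)
  simp only [hf, add_zero] at hfin
  rw [extStrip_eq (hηS _ (right_mem_Icc.2 ht)) ht₁,
    extStrip_eq (hηS _ (left_mem_Icc.2 ht)) ht₀] at hfin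
  linarith

/-! ### Competitors, dynamic programming and the subsolution property. -/

section costs

variable {ℓ : ℝ} {H : ℝ → ℝ → ℝ → ℝ} {U₀ : ℝ × ℝ → ℝ}

theorem isCompact_rightParabolicBoundary_inter (ℓ T : ℝ) :
    IsCompact (rightParabolicBoundary ℓ ∩ univ ×ˢ Icc 0 T) := by
  have h : rightParabolicBoundary ℓ ∩ univ ×ˢ Icc 0 T =
      (Icc 0 ℓ ×ˢ ({0} ∩ Icc 0 T)) ∪ ({ℓ} ×ˢ Icc 0 T) := by
    ext ⟨s, t⟩
    simp only [rightParabolicBoundary, mem_inter_iff, mem_union, mem_prod, mem_univ, true_and,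
      mem_singleton_iff, mem_Icc, mem_Ici]
    tauto
  rw [h]
  exact (isCompact_Icc.prod (isCompact_singleton.inter_right isClosed_Icc)).union
    (isCompact_singleton.prod isCompact_Icc)

theorem rightParabolicBoundary_subset (hℓ : 0 ≤ ℓ) :
    rightParabolicBoundary ℓ ⊆ closedArcStrip ℓ := by
  rintro ⟨s, t⟩ (⟨hs, ht⟩ | ⟨hs, ht⟩)
  · exact ⟨hs, (show t = 0 from ht).ge⟩
  · obtain rfl : s = ℓ := hs
    exact ⟨⟨hℓ, le_rfl⟩, ht⟩

theorem exists_abs_le_of_mem_boundary (hU₀ : ContinuousOn U₀ (rightParabolicBoundary ℓ)) (T : ℝ) :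
    ∃ m : ℝ, 0 ≤ m ∧ ∀ s t : ℝ, (s, t) ∈ rightParabolicBoundary ℓ → t ∈ Icc 0 T →
      |U₀ (s, t)| ≤ m := by
  obtain ⟨m, hm⟩ := (isCompact_rightParabolicBoundary_inter ℓ T).exists_bound_of_continuousOn
    (hU₀.mono inter_subset_left)
  exact ⟨max m 0, le_max_right _ _, fun s t h ht => (hm (s, t) ⟨h, mem_univ _, ht⟩).trans
    (le_max_left _ _)⟩

theorem const_mem_arcCosts (hℓ : 0 ≤ ℓ) (hH : IsArcHamiltonian ℓ H) {s t : ℝ} (hs : s ∈ Icc 0 ℓ)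
    (ht : 0 ≤ t) :
    U₀ (s, 0) + ∫ τ in (0 : ℝ)..t, extLagrangian ℓ H s 0 τ ∈ arcCosts ℓ H U₀ s t := by
  have hc : Continuous fun τ => extLagrangian ℓ H s 0 τ :=
    Continuous.extLagrangian_comp hH hℓ (by fun_prop) (by fun_prop) (by fun_prop)
  have he : EqOn (fun τ => extLagrangian ℓ H s 0 τ)
      (fun τ => arcLagrangian H s (deriv (fun _ : ℝ => s) τ) τ) (uIcc 0 t) := by
    intro τ hτ
    rw [uIcc_of_le ht] at hτ
    simp only [deriv_const]
    exact extLagrangian_eq hs hτ.1 0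
  refine ⟨0, fun _ => s, ⟨le_rfl, ht⟩, ?_, fun _ _ => hs, rfl, Or.inl ⟨hs, rfl⟩, ?_, ?_⟩
  · exact contDiffOn_const.absolutelyContinuousOnInterval
  · exact (hc.intervalIntegrable 0 t).congr fun τ hτ => he (uIoc_subset_uIcc hτ)
  · rw [intervalIntegral.integral_congr he]

theorem bddBelow_arcCosts (hH : IsArcHamiltonian ℓ H)
    (hU₀ : ContinuousOn U₀ (rightParabolicBoundary ℓ)) {s t : ℝ} :
    BddBelow (arcCosts ℓ H U₀ s t) := by
  rcases lt_or_ge t 0 with ht | ht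
  · refine ⟨0, ?_⟩
    rintro c ⟨t₀, η, ht₀, -⟩
    exact absurd (ht₀.1.trans ht₀.2) (not_le.2 ht)
  obtain ⟨m, hm0, hm⟩ := exists_abs_le_of_mem_boundary hU₀ t
  obtain ⟨C, hC0, hC⟩ := hH.exists_arcLagrangian_ge (T := t + 1) (by linarith) le_rfl
  refine ⟨-m - C * t, ?_⟩
  rintro c ⟨t₀, η, ht₀, hη, hηS, -, hb, hint, rfl⟩
  have h1 := neg_le_of_abs_le (hm _ _ hb ht₀)
  have h2 : ∫ τ in t₀..t, -C ≤ ∫ τ in t₀..t, arcLagrangian H (η τ) (deriv η τ) τ := by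
    refine intervalIntegral.integral_mono_on ht₀.2 intervalIntegrable_const hint fun τ hτ => ?_
    have := hC _ (hηS τ hτ) τ ⟨ht₀.1.trans hτ.1, by linarith [hτ.2]⟩ (deriv η τ)
    linarith
  rw [intervalIntegral.integral_const, smul_eq_mul] at h2
  have h3 : C * (t - t₀) ≤ C * t := by
    have := ht₀.1
    gcongr; linarith
  linarith

theorem isGLB_arcValueFunction (hℓ : 0 ≤ ℓ) (hH : IsArcHamiltonian ℓ H)
    (hU₀ : ContinuousOn U₀ (rightParabolicBoundary ℓ)) {s t : ℝ} (hs : s ∈ Icc 0 ℓ) (ht : 0 ≤ t) :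
    IsGLB (arcCosts ℓ H U₀ s t) (arcValueFunction ℓ H U₀ (s, t)) :=
  isGLB_csInf ⟨_, const_mem_arcCosts hℓ hH hs ht⟩ (bddBelow_arcCosts hH hU₀)

theorem arcValueFunction_le_boundary (hℓ : 0 ≤ ℓ) (hH : IsArcHamiltonian ℓ H)
    (hU₀ : ContinuousOn U₀ (rightParabolicBoundary ℓ)) {p : ℝ × ℝ}
    (hp : p ∈ rightParabolicBoundary ℓ) : arcValueFunction ℓ H U₀ p ≤ U₀ p := by
  obtain ⟨s, t⟩ := p
  obtain ⟨hs, ht⟩ := rightParabolicBoundary_subset hℓ hp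
  refine (isGLB_arcValueFunction hℓ hH hU₀ hs ht).1 ⟨t, fun _ => s, ⟨ht, le_rfl⟩, ?_,
    fun _ _ => hs, rfl, hp, by simp, by simp⟩
  exact contDiffOn_const.absolutelyContinuousOnInterval

theorem AbsolutelyContinuousOnInterval.congr {f g : ℝ → ℝ} {a b : ℝ}
    (hf : AbsolutelyContinuousOnInterval f a b) (h : EqOn f g (uIcc a b)) :
    AbsolutelyContinuousOnInterval g a b := by
  refine Tendsto.congr' ?_ hf
  filter_upwards [mem_inf_of_right (mem_principal_self _)] with E hE
  refine Finset.sum_congr rfl fun i hi => ?_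
  obtain ⟨h1, h2⟩ := hE.1 i hi
  rw [h h1, h h2]

/-- A competitor can be prolonged by a segment. -/
theorem add_segment_mem_arcCosts (hℓ : 0 ≤ ℓ) (hH : IsArcHamiltonian ℓ H) {x v t₁ t₂ c : ℝ}
    (ht : t₁ ≤ t₂) (hx : ∀ τ ∈ Icc t₁ t₂, x + v * τ ∈ Icc 0 ℓ)
    (hc : c ∈ arcCosts ℓ H U₀ (x + v * t₁) t₁) :
    c + ∫ τ in t₁..t₂, extLagrangian ℓ H (x + v * τ) v τ ∈ arcCosts ℓ H U₀ (x + v * t₂) t₂ := by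
  obtain ⟨t₀, η, ht₀, hη, hηS, hηt, hb, hint, rfl⟩ := hc
  -- Absolute continuity of the concatenation `ζ` comes from writing it as `η t₀` plus the integral
  -- of the glued velocity `f`.
  set f : ℝ → ℝ := fun τ => if τ ≤ t₁ then deriv η τ else v with hf
  set ζ : ℝ → ℝ := fun τ => if τ ≤ t₁ then η τ else x + v * τ with hζ
  have hf1 : IntervalIntegrable f volume t₀ t₁ := by
    refine hη.intervalIntegrable_deriv.congr fun τ hτ => ?_
    rw [uIoc_of_le ht₀.2] at hτ
    simp only [hf, if_pos hτ.2]
  have hf2 : IntervalIntegrable f volume t₁ t₂ := by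
    refine (intervalIntegrable_const (c := v)).congr fun τ hτ => ?_
    rw [uIoc_of_le ht] at hτ
    simp only [hf, if_neg (not_le.2 hτ.1)]
  have hζ1 : ∀ τ ∈ Icc t₀ t₁, ζ τ = η τ := fun τ hτ => if_pos hτ.2
  have hζ2 : ∀ τ ∈ Icc t₁ t₂, ζ τ = x + v * τ := fun τ hτ => by
    rcases hτ.1.eq_or_lt with rfl | h
    · simp [hζ, hηt]
    · exact if_neg (not_le.2 h)
  have heq1 : ∀ τ ∈ Icc t₀ t₁, η t₀ + ∫ r in t₀..τ, f r = η τ := by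
    intro τ hτ
    have h1 : ∫ r in t₀..τ, f r = ∫ r in t₀..τ, deriv η r := by
      refine intervalIntegral.integral_congr fun r hr => ?_
      rw [uIcc_of_le hτ.1] at hr
      simp only [hf, if_pos (hr.2.trans hτ.2)]
    have h2 : AbsolutelyContinuousOnInterval η t₀ τ := hη.mono (by
      rw [uIcc_of_le hτ.1, uIcc_of_le ht₀.2]; exact Icc_subset_Icc_right hτ.2)
    rw [h1, h2.integral_deriv_eq_sub]; ring
  have heq2 : ∀ τ ∈ Icc t₁ t₂, η t₀ + ∫ r in t₀..τ, f r = x + v * τ := by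
    intro τ hτ
    have h1 : ∫ r in t₁..τ, f r = ∫ r in t₁..τ, v := by
      refine intervalIntegral.integral_congr_ae (Eventually.of_forall fun r hr => ?_)
      rw [uIoc_of_le hτ.1] at hr
      simp only [hf, if_neg (not_le.2 hr.1)]
    have h2 : IntervalIntegrable f volume t₁ τ := hf2.mono_set (by
      rw [uIcc_of_le hτ.1, uIcc_of_le ht]; exact Icc_subset_Icc_right hτ.2)
    rw [← intervalIntegral.integral_add_adjacent_intervals hf1 h2, ← add_assoc,
      heq1 t₁ ⟨ht₀.2, le_rfl⟩, h1, hηt, intervalIntegral.integral_const, smul_eq_mul]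
    ring
  have hζAC : AbsolutelyContinuousOnInterval ζ t₀ t₂ := by
    have h1 := (hf1.trans hf2).absolutelyContinuousOnInterval_intervalIntegral (c := t₀)
      left_mem_uIcc
    have h2 : AbsolutelyContinuousOnInterval (fun _ : ℝ => η t₀) t₀ t₂ :=
      contDiffOn_const.absolutelyContinuousOnInterval
    refine (h2.add h1).congr fun τ hτ => ?_
    rw [uIcc_of_le (ht₀.2.trans ht)] at hτ
    rcases le_total τ t₁ with h | h
    · rw [hζ1 τ ⟨hτ.1, h⟩]; exact heq1 τ ⟨hτ.1, h⟩
    · rw [hζ2 τ ⟨h, hτ.2⟩]; exact heq2 τ ⟨h, hτ.2⟩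
  have hae1 : ∀ᵐ τ, τ ∈ uIoc t₀ t₁ → arcLagrangian H (η τ) (deriv η τ) τ =
      arcLagrangian H (ζ τ) (deriv ζ τ) τ := by
    filter_upwards [ae_ne_real t₁] with τ hne hτ
    rw [uIoc_of_le ht₀.2] at hτ
    have hlt : τ < t₁ := lt_of_le_of_ne hτ.2 hne
    have : ζ =ᶠ[𝓝 τ] η := by
      filter_upwards [Iio_mem_nhds hlt] with r hr using if_pos (le_of_lt hr)
    rw [this.deriv_eq, this.eq_of_nhds]
  have hae2 : ∀ᵐ τ, τ ∈ uIoc t₁ t₂ → extLagrangian ℓ H (x + v * τ) v τ =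
      arcLagrangian H (ζ τ) (deriv ζ τ) τ := by
    refine Eventually.of_forall fun τ hτ => ?_
    rw [uIoc_of_le ht] at hτ
    have : ζ =ᶠ[𝓝 τ] fun τ => x + v * τ := by
      filter_upwards [Ioi_mem_nhds hτ.1] with r hr using if_neg (not_le.2 hr)
    have hd : HasDerivAt (fun τ => x + v * τ) v τ := by
      simpa using ((hasDerivAt_id τ).const_mul v).const_add x
    rw [this.deriv_eq, this.eq_of_nhds, hd.deriv]
    exact extLagrangian_eq (hx τ ⟨hτ.1.le, hτ.2⟩) ((ht₀.1.trans ht₀.2).trans hτ.1.le) v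
  have hLc : Continuous fun τ => extLagrangian ℓ H (x + v * τ) v τ :=
    Continuous.extLagrangian_comp hH hℓ (by fun_prop) (by fun_prop) (by fun_prop)
  have hi1 : IntervalIntegrable (fun τ => arcLagrangian H (ζ τ) (deriv ζ τ) τ) volume t₀ t₁ :=
    hint.congr_ae ((ae_restrict_iff' measurableSet_uIoc).2 hae1)
  have hi2 : IntervalIntegrable (fun τ => arcLagrangian H (ζ τ) (deriv ζ τ) τ) volume t₁ t₂ :=
    (hLc.intervalIntegrable _ _).congr_ae ((ae_restrict_iff' measurableSet_uIoc).2 hae2)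
  have hζ0 : ζ t₀ = η t₀ := hζ1 t₀ ⟨le_rfl, ht₀.2⟩
  refine ⟨t₀, ζ, ⟨ht₀.1, ht₀.2.trans ht⟩, hζAC, fun τ hτ => ?_, hζ2 t₂ ⟨ht, le_rfl⟩,
    by rwa [hζ0], hi1.trans hi2, ?_⟩
  · rcases le_total τ t₁ with h | h
    · rw [hζ1 τ ⟨hτ.1, h⟩]; exact hηS τ ⟨hτ.1, h⟩
    · rw [hζ2 τ ⟨h, hτ.2⟩]; exact hx τ ⟨h, hτ.2⟩
  · rw [← intervalIntegral.integral_add_adjacent_intervals hi1 hi2,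
      intervalIntegral.integral_congr_ae hae1, intervalIntegral.integral_congr_ae hae2, hζ0]
    ring

/-- The dynamic programming inequality along a segment. -/
theorem arcValueFunction_le_add_segment (hℓ : 0 ≤ ℓ) (hH : IsArcHamiltonian ℓ H)
    (hU₀ : ContinuousOn U₀ (rightParabolicBoundary ℓ)) {x v t₁ t₂ : ℝ} (ht₁ : 0 ≤ t₁)
    (ht : t₁ ≤ t₂) (hx₁ : x + v * t₁ ∈ Icc 0 ℓ) (hx₂ : x + v * t₂ ∈ Icc 0 ℓ) :
    arcValueFunction ℓ H U₀ (x + v * t₂, t₂) ≤ arcValueFunction ℓ H U₀ (x + v * t₁, t₁) +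
      ∫ τ in t₁..t₂, extLagrangian ℓ H (x + v * τ) v τ := by
  rw [← sub_le_iff_le_add]
  refine (isGLB_arcValueFunction hℓ hH hU₀ hx₁ ht₁).2 fun c hc => ?_
  rw [sub_le_iff_le_add]
  exact (isGLB_arcValueFunction hℓ hH hU₀ hx₂ (ht₁.trans ht)).1
    (add_segment_mem_arcCosts hℓ hH ht (segment_mem_Icc hx₁ hx₂) hc)

/-- Reach `(s, t)` along a segment whose velocity `v` gives Fenchel equality at the momentum of `ψ`.
Dynamic programming and the local maximum bound the increment of `ψ` by the action over `[t - h,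
t]`; differentiating at `h = 0` gives the inequality. No minimizer is needed. -/
theorem isViscositySubsolution_arcValueFunction (hℓ : 0 ≤ ℓ) (hH : IsArcHamiltonian ℓ H)
    (hU₀ : ContinuousOn U₀ (rightParabolicBoundary ℓ)) :
    IsViscositySubsolution ℓ H (arcValueFunction ℓ H U₀) := by
  intro ψ hψ s t hst hmax
  have hopen : IsOpen (arcStrip ℓ) := isOpen_Ioo.prod isOpen_Ioi
  have hfd : HasFDerivAt ψ (fderiv ℝ ψ (s, t)) (s, t) :=
    ((hψ.contDiffAt (hopen.mem_nhds hst)).differentiableAt one_ne_zero).hasFDerivAt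
  set D := fderiv ℝ ψ (s, t) with hD
  have hsI : s ∈ Icc 0 ℓ := Ioo_subset_Icc_self hst.1
  have ht0 : 0 < t := hst.2
  have hd1 : HasDerivAt (fun r => ψ (s, r)) (D (0, 1)) t :=
    hfd.comp_hasDerivAt t ((hasDerivAt_const t s).prodMk (hasDerivAt_id t))
  have hd2 : HasDerivAt (fun r => ψ (r, t)) (D (1, 0)) s :=
    hfd.comp_hasDerivAt s ((hasDerivAt_id s).prodMk (hasDerivAt_const s t))
  rw [hd1.deriv, hd2.deriv]
  obtain ⟨v, hv⟩ := hH.exists_arcLagrangian_le hsI ht0.le (D (1, 0))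
  set x := s - v * t with hx
  have hxt : x + v * t = s := by simp [hx]
  have hpath : HasDerivAt (fun h : ℝ => (x + v * (t - h), t - h)) (-v, -1) 0 := by
    have h1 : HasDerivAt (fun h : ℝ => t - h) (-1) 0 := by
      simpa using (hasDerivAt_id (0 : ℝ)).const_sub t
    have h2 := (h1.const_mul v).const_add x
    simpa using h2.prodMk h1
  have hψd : HasDerivAt (fun h : ℝ => ψ (x + v * (t - h), t - h)) (D (-v, -1)) 0 := by
    refine HasFDerivAt.comp_hasDerivAt (f := fun h : ℝ => (x + v * (t - h), t - h)) 0 ?_ hpath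
    simpa [hxt] using hfd
  have hLc : Continuous fun τ => extLagrangian ℓ H (x + v * τ) v τ :=
    Continuous.extLagrangian_comp hH hℓ (by fun_prop) (by fun_prop) (by fun_prop)
  have hI : HasDerivAt (fun h : ℝ => ∫ τ in (t - h)..t, extLagrangian ℓ H (x + v * τ) v τ)
      (extLagrangian ℓ H (x + v * t) v t) 0 := by
    have h1 : HasDerivAt (fun r => ∫ τ in r..t, extLagrangian ℓ H (x + v * τ) v τ)
        (-extLagrangian ℓ H (x + v * (t - 0)) v (t - 0)) (t - 0) :=
      intervalIntegral.integral_hasDerivAt_left (hLc.intervalIntegrable _ _)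
        hLc.aestronglyMeasurable.stronglyMeasurableAtFilter hLc.continuousAt
    have h2 : HasDerivAt (fun h : ℝ => t - h) (-1) 0 := by
      simpa using (hasDerivAt_id (0 : ℝ)).const_sub t
    have h3 := h1.comp 0 h2
    simpa using! h3
  have hfin := ((hI.sub_const (ψ (s, t))).add hψd).nonneg_of_nonneg_right (by simp [hxt]) (by
    have htend : Tendsto (fun h : ℝ => (x + v * (t - h), t - h)) (𝓝[>] 0) (𝓝 (s, t)) := by
      have := hpath.continuousAt.tendsto.mono_left (nhdsWithin_le_nhds (s := Ioi 0))
      simpa [hxt] using this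
    filter_upwards [htend.eventually hmax, htend.eventually (hopen.mem_nhds hst),
      self_mem_nhdsWithin] with h h1 h2 h3
    have h3' : 0 < h := h3
    have h4 := arcValueFunction_le_add_segment hℓ hH hU₀ (x := x) (v := v) (t₁ := t - h) (t₂ := t)
      (le_of_lt h2.2) (by linarith) (Ioo_subset_Icc_self h2.1) (by rwa [hxt])
    rw [hxt] at h4
    simp only [Pi.add_apply]
    linarith)
  rw [hxt, extLagrangian_eq hsI ht0.le] at hfin
  have hlin : D (-v, -1) = -(v * D (1, 0)) - D (0, 1) := by
    have : ((-v, -1) : ℝ × ℝ) = (-v) • ((1, 0) : ℝ × ℝ) + (-1 : ℝ) • ((0, 1) : ℝ × ℝ) := by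
      ext <;> simp
    rw [this, map_add, map_smul, map_smul]
    simp; ring
  rw [hlin] at hfin
  linarith

end costs

/-! ### Continuity of the value function. -/

section continuity

variable {ℓ : ℝ} {H : ℝ → ℝ → ℝ → ℝ} {U₀ : ℝ × ℝ → ℝ}

/-- Discarding pieces of total length at most `T` costs at most `C * T`, since `f ≥ -C` on them. -/
theorem integral_add_const_mono {f : ℝ → ℝ} {t₀ t₁ a b C T : ℝ} (h0 : 0 ≤ C)
    (hf : IntervalIntegrable f volume t₀ t₁) (hge : ∀ τ ∈ Icc t₀ t₁, -C ≤ f τ) (ha : t₀ ≤ a)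
    (hab : a ≤ b) (hb : b ≤ t₁) (hT : t₁ - t₀ - (b - a) ≤ T) :
    ∫ τ in a..b, f τ ≤ (∫ τ in t₀..t₁, f τ) + C * T := by
  have hsub : ∀ {c d : ℝ}, t₀ ≤ c → c ≤ d → d ≤ t₁ → IntervalIntegrable f volume c d ∧
      -C * (d - c) ≤ ∫ τ in c..d, f τ := by
    intro c d hc hcd hd
    have hi : IntervalIntegrable f volume c d := hf.mono_set (by
      rw [uIcc_of_le hcd, uIcc_of_le (hc.trans (hcd.trans hd))]; exact Icc_subset_Icc hc hd)
    refine ⟨hi, ?_⟩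
    have := intervalIntegral.integral_mono_on hcd (intervalIntegrable_const (c := -C)) hi
      fun τ hτ => hge τ ⟨hc.trans hτ.1, hτ.2.trans hd⟩
    rw [intervalIntegral.integral_const, smul_eq_mul] at this
    linarith
  obtain ⟨i1, h1⟩ := hsub le_rfl ha (hab.trans hb)
  obtain ⟨i2, -⟩ := hsub ha hab hb
  obtain ⟨i3, h3⟩ := hsub (ha.trans hab) hb le_rfl
  rw [← intervalIntegral.integral_add_adjacent_intervals (i1.trans i2) i3,
    ← intervalIntegral.integral_add_adjacent_intervals i1 i2]
  have := mul_le_mul_of_nonneg_left hT h0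
  linarith

/-- Curves of bounded action are uniformly of bounded variation and equicontinuous. -/
theorem IsArcHamiltonian.exists_variation_bound (hH : IsArcHamiltonian ℓ H) {T : ℝ} (hT : 0 < T)
    (Q : ℝ) :
    ∃ D : ℝ, ∀ k : ℝ, 0 < k → ∃ C : ℝ, 0 ≤ C ∧ ∀ (η : ℝ → ℝ) (t₀ t₁ : ℝ), 0 ≤ t₀ → t₁ ≤ T →
      AbsolutelyContinuousOnInterval η t₀ t₁ → (∀ τ ∈ Icc t₀ t₁, η τ ∈ Icc 0 ℓ) →
      IntervalIntegrable (fun τ => arcLagrangian H (η τ) (deriv η τ) τ) volume t₀ t₁ →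
      ∫ τ in t₀..t₁, arcLagrangian H (η τ) (deriv η τ) τ ≤ Q →
      ∀ a b : ℝ, t₀ ≤ a → a ≤ b → b ≤ t₁ →
        k * ∫ τ in a..b, |deriv η τ| ≤ Q + D * T + C * (b - a) := by
  -- `D` is fixed before `k`: dividing by a large `k` makes the constant part small, and a short
  -- interval then handles `C * (b - a)`. This gives equicontinuity.
  obtain ⟨D, hD0, hD⟩ := hH.exists_arcLagrangian_ge hT le_rfl
  refine ⟨D, fun k hk => ?_⟩
  obtain ⟨C, hC0, hC⟩ := hH.exists_arcLagrangian_ge hT hk.le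
  refine ⟨C, hC0, fun η t₀ t₁ ht₀ ht₁ hη hηS hint hQ a b ha hab hb => ?_⟩
  have h1 := integral_add_const_mono (T := T) hD0 hint (fun τ hτ => by
    have := hD _ (hηS τ hτ) τ ⟨ht₀.trans hτ.1, hτ.2.trans ht₁⟩ (deriv η τ)
    linarith) ha hab hb (by linarith)
  have hsub : uIcc a b ⊆ uIcc t₀ t₁ := by
    rw [uIcc_of_le hab, uIcc_of_le (ha.trans (hab.trans hb))]; exact Icc_subset_Icc ha hb
  have hi := (hη.mono hsub).intervalIntegrable_deriv.abs
  have h2 := intervalIntegral.integral_mono_on hab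
    ((hi.const_mul k).sub (intervalIntegrable_const (c := C))) (hint.mono_set hsub)
    fun τ hτ => hC _ (hηS τ ⟨ha.trans hτ.1, hτ.2.trans hb⟩) τ
      ⟨ht₀.trans (ha.trans hτ.1), (hτ.2.trans hb).trans ht₁⟩ (deriv η τ)
  rw [intervalIntegral.integral_sub (hi.const_mul k) intervalIntegrable_const,
    intervalIntegral.integral_const_mul, intervalIntegral.integral_const, smul_eq_mul] at h2
  linarith

theorem abs_sub_le_integral_abs_deriv {η : ℝ → ℝ} {a b : ℝ} (hab : a ≤ b)
    (hη : AbsolutelyContinuousOnInterval η a b) : |η b - η a| ≤ ∫ τ in a..b, |deriv η τ| := by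
  rw [← hη.integral_deriv_eq_sub]
  exact intervalIntegral.abs_integral_le_integral_abs hab

/-- The Lagrangian along a curve, evaluated at times delayed by `δ`. -/
theorem IsArcHamiltonian.integral_delayed_le (hℓ : 0 ≤ ℓ) (hH : IsArcHamiltonian ℓ H)
    {T K δ C : ℝ} (hδ : 0 ≤ δ)
    (hlip : ∀ s ∈ Icc 0 ℓ, ∀ t ∈ Icc δ T, ∀ v : ℝ,
      arcLagrangian H s v (t - δ) ≤ arcLagrangian H s v t + K * (1 + |v|) * δ)
    (hC : ∀ s ∈ Icc 0 ℓ, ∀ t ∈ Icc 0 T, ∀ v : ℝ, -C ≤ arcLagrangian H s v t)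
    {η : ℝ → ℝ} {a b : ℝ} (ha : δ ≤ a) (hab : a ≤ b) (hb : b ≤ T)
    (hη : AbsolutelyContinuousOnInterval η a b) (hηS : ∀ τ ∈ Icc a b, η τ ∈ Icc 0 ℓ)
    (hint : IntervalIntegrable (fun τ => arcLagrangian H (η τ) (deriv η τ) τ) volume a b) :
    IntervalIntegrable (fun τ => arcLagrangian H (η τ) (deriv η τ) (τ - δ)) volume a b ∧
    ∫ τ in a..b, arcLagrangian H (η τ) (deriv η τ) (τ - δ) ≤
      (∫ τ in a..b, arcLagrangian H (η τ) (deriv η τ) τ) +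
        K * δ * ∫ τ in a..b, (1 + |deriv η τ|) := by
  have hder : IntervalIntegrable (fun τ => 1 + |deriv η τ|) volume a b :=
    intervalIntegrable_const.add hη.intervalIntegrable_deriv.abs
  have hupper : ∀ τ ∈ Icc a b, arcLagrangian H (η τ) (deriv η τ) (τ - δ) ≤
      arcLagrangian H (η τ) (deriv η τ) τ + K * δ * (1 + |deriv η τ|) := fun τ hτ => by
    have := hlip _ (hηS τ hτ) τ ⟨ha.trans hτ.1, hτ.2.trans hb⟩ (deriv η τ)
    linarith
  have hi : IntervalIntegrable (fun τ => arcLagrangian H (η τ) (deriv η τ) (τ - δ)) volume a b := by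
    have hbound := ((hint.add (hder.const_mul (K * δ))).abs).add
      (intervalIntegrable_const (c := |C|))
    -- The delayed integrand is measurable by continuity of the Lagrangian, and it lies between `-C`
    -- and the integrable upper bound `hupper`.
    rw [intervalIntegrable_iff_integrableOn_Icc_of_le hab] at hbound ⊢
    refine Integrable.mono' hbound ?_ ?_
    · have hηm : AEStronglyMeasurable η (volume.restrict (Icc a b)) := by
        have := hη.continuousOn
        rw [uIcc_of_le hab] at this
        exact this.aestronglyMeasurable measurableSet_Icc
      have hdm : AEStronglyMeasurable (deriv η) (volume.restrict (Icc a b)) :=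
        (measurable_deriv η).aestronglyMeasurable
      have htm : AEStronglyMeasurable (fun τ : ℝ => τ - δ) (volume.restrict (Icc a b)) :=
        (by fun_prop : Continuous fun τ : ℝ => τ - δ).aestronglyMeasurable
      refine ((hH.continuous_extLagrangian hℓ).comp_aestronglyMeasurable
        (hηm.prodMk (hdm.prodMk htm))).congr ?_
      filter_upwards [ae_restrict_mem measurableSet_Icc] with τ hτ
      exact extLagrangian_eq (hηS τ hτ) (by linarith [hτ.1]) _
    · filter_upwards [ae_restrict_mem measurableSet_Icc] with τ hτ
      have h1 := hupper τ hτ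
      have h2 := hC _ (hηS τ hτ) (τ - δ) ⟨by linarith [hτ.1], by linarith [hτ.2]⟩ (deriv η τ)
      have h3 := le_abs_self C
      have h4 := le_abs_self (arcLagrangian H (η τ) (deriv η τ) τ + K * δ * (1 + |deriv η τ|))
      rw [Real.norm_eq_abs, abs_le]
      have h5 := abs_nonneg C
      have h6 := abs_nonneg (arcLagrangian H (η τ) (deriv η τ) τ + K * δ * (1 + |deriv η τ|))
      constructor <;> linarith
  refine ⟨hi, ?_⟩
  rw [← intervalIntegral.integral_const_mul,
    ← intervalIntegral.integral_add hint (hder.const_mul _)]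
  exact intervalIntegral.integral_mono_on hab hi (hint.add (hder.const_mul _)) hupper

theorem AbsolutelyContinuousOnInterval.comp_add_right {η : ℝ → ℝ} {a b : ℝ}
    (hη : AbsolutelyContinuousOnInterval η a b) (hab : a ≤ b) (δ : ℝ) :
    AbsolutelyContinuousOnInterval (fun τ => η (τ + δ)) (a - δ) (b - δ) := by
  have h1 : IntervalIntegrable (fun τ => deriv η (τ + δ)) volume (a - δ) (b - δ) :=
    hη.intervalIntegrable_deriv.comp_add_right δ
  have h2 := h1.absolutelyContinuousOnInterval_intervalIntegral (c := a - δ) left_mem_uIcc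
  have h3 : AbsolutelyContinuousOnInterval (fun _ : ℝ => η a) (a - δ) (b - δ) :=
    contDiffOn_const.absolutelyContinuousOnInterval
  refine (h3.add h2).congr fun τ hτ => ?_
  rw [uIcc_of_le (by linarith)] at hτ
  have h4 : AbsolutelyContinuousOnInterval η a (τ + δ) := hη.mono (by
    rw [uIcc_of_le (by linarith [hτ.1]), uIcc_of_le hab]
    exact Icc_subset_Icc_right (by linarith [hτ.2]))
  simp only [Pi.add_apply]
  rw [intervalIntegral.integral_comp_add_right (deriv η), sub_add_cancel,
    h4.integral_deriv_eq_sub]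
  ring

theorem exists_arcValueFunction_le (hℓ : 0 ≤ ℓ) (hH : IsArcHamiltonian ℓ H)
    (hU₀ : ContinuousOn U₀ (rightParabolicBoundary ℓ)) {T : ℝ} (hT : 0 ≤ T) :
    ∃ M : ℝ, ∀ s ∈ Icc 0 ℓ, ∀ t ∈ Icc 0 T, arcValueFunction ℓ H U₀ (s, t) ≤ M := by
  obtain ⟨m, hm0, hm⟩ := exists_abs_le_of_mem_boundary hU₀ T
  have hLc : Continuous fun p : ℝ × ℝ => extLagrangian ℓ H p.1 0 p.2 :=
    Continuous.extLagrangian_comp hH hℓ (by fun_prop) (by fun_prop) (by fun_prop)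
  obtain ⟨N, hN⟩ := (isCompact_Icc (a := 0) (b := ℓ) |>.prod
    (isCompact_Icc (a := 0) (b := T))).exists_bound_of_continuousOn hLc.continuousOn
  refine ⟨m + |N| * T, fun s hs t ht => ?_⟩
  refine ((isGLB_arcValueFunction hℓ hH hU₀ hs ht.1).1 (const_mem_arcCosts hℓ hH hs ht.1)).trans ?_
  have h1 := le_of_abs_le (hm s 0 (Or.inl ⟨hs, rfl⟩) ⟨le_rfl, hT⟩)
  have h2 : ‖∫ τ in (0 : ℝ)..t, extLagrangian ℓ H s 0 τ‖ ≤ |N| * |t - 0| := by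
    refine intervalIntegral.norm_integral_le_of_norm_le_const fun r hr => ?_
    rw [uIoc_of_le ht.1] at hr
    exact (hN (s, r) ⟨hs, hr.1.le, hr.2.trans ht.2⟩).trans (le_abs_self N)
  have h3 := le_of_abs_le (Real.norm_eq_abs _ ▸ h2)
  rw [sub_zero, abs_of_nonneg ht.1] at h3
  have h4 := mul_le_mul_of_nonneg_left ht.2 (abs_nonneg N)
  linarith

/-- Locally uniform control of the value function backward in time. -/
theorem exists_arcValueFunction_le_add_time (hℓ : 0 ≤ ℓ) (hH : IsArcHamiltonian ℓ H)
    (hU₀ : ContinuousOn U₀ (rightParabolicBoundary ℓ)) {T : ℝ} (hT : 0 ≤ T) {ε : ℝ} (hε : 0 < ε) :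
    ∃ δ₀ : ℝ, 0 < δ₀ ∧ ∀ δ ∈ Ioo 0 δ₀, ∀ s ∈ Icc 0 ℓ, ∀ t ∈ Icc 0 T,
      arcValueFunction ℓ H U₀ (s, t) ≤ arcValueFunction ℓ H U₀ (s, t + δ) + ε := by
  have hT1 : 0 < T + 1 := by linarith
  obtain ⟨M, hM⟩ := exists_arcValueFunction_le hℓ hH hU₀ hT1.le
  obtain ⟨m, hm0, hm⟩ := exists_abs_le_of_mem_boundary hU₀ (T + 1)
  obtain ⟨K, ε₁, hK, hε₁, hlip⟩ := hH.exists_arcLagrangian_time_lipschitz hT1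
  obtain ⟨C, hC0, hC⟩ := hH.exists_arcLagrangian_ge hT1 le_rfl
  have hC' : ∀ s ∈ Icc 0 ℓ, ∀ t ∈ Icc 0 (T + 1), ∀ v : ℝ, -C ≤ arcLagrangian H s v t := by
    intro s hs t ht v
    have := hC s hs t ht v
    linarith
  set Q := M + ε + m with hQ
  have hcomp := isCompact_rightParabolicBoundary_inter ℓ (T + 1)
  obtain ⟨ρ, hρ, hUu⟩ := Metric.uniformContinuousOn_iff.1
    (hcomp.uniformContinuousOn_of_continuous (hU₀.mono inter_subset_left)) (ε / 4) (by positivity)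
  obtain ⟨D, hvar⟩ := hH.exists_variation_bound hT1 Q
  obtain ⟨C₁, hC₁, hvar₁⟩ := hvar 1 one_pos
  set S := |Q + D * (T + 1) + C₁ * (T + 1)| with hS
  -- With this `k` the fixed part of the variation bound is less than `k * (ρ / 2)`; the choice of
  -- `δ` puts the other part below `k * (ρ / 2)` too, so the starting point moves by less than `ρ`.
  set k := (|Q + D * (T + 1)| + 1) / (ρ / 2) with hk
  have hk0 : 0 < k := by positivity
  have hkρ : k * (ρ / 2) = |Q + D * (T + 1)| + 1 := by rw [hk]; field_simp
  obtain ⟨C₂, hC₂, hvar₂⟩ := hvar k hk0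
  set E := C + K * (T + 1 + S) + 1 with hE
  have hS0 : 0 ≤ S := abs_nonneg _
  have hE0 : 0 < E := by positivity
  refine ⟨min (min 1 ε₁) (min ρ (min (k * (ρ / 2) / (C₂ + 1)) (ε / 4 / E))), by positivity,
    fun δ hδ s hs t ht => ?_⟩
  obtain ⟨hδ0, hδm⟩ := hδ
  simp only [lt_min_iff] at hδm
  obtain ⟨⟨hδ1, hδε⟩, hδρ, hδk, hδE⟩ := hδm
  rw [lt_div_iff₀ (by positivity)] at hδk hδE
  have htδ : t + δ ∈ Icc 0 (T + 1) := ⟨by linarith [ht.1], by linarith [ht.2]⟩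
  obtain ⟨c, ⟨t₀, η, ht₀, hη, hηS, hηt, hb, hint, rfl⟩, -, hc⟩ :=
    (isGLB_arcValueFunction hℓ hH hU₀ hs htδ.1).exists_between
      (show arcValueFunction ℓ H U₀ (s, t + δ) < arcValueFunction ℓ H U₀ (s, t + δ) + ε / 2 by
        linarith)
  have ht₀T : t₀ ∈ Icc 0 (T + 1) := ⟨ht₀.1, ht₀.2.trans htδ.2⟩
  have hQ' : ∫ τ in t₀..(t + δ), arcLagrangian H (η τ) (deriv η τ) τ ≤ Q := by
    have h1 := hM s hs (t + δ) htδ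
    have h2 := neg_le_of_abs_le (hm _ _ hb ht₀T)
    linarith
  -- The part of the curve before time `δ` is cut off, since it would be translated to negative
  -- times.
  set a := max t₀ δ with ha
  have hat₀ : t₀ ≤ a := le_max_left _ _
  have haδ : δ ≤ a := le_max_right _ _
  have hat : a ≤ t + δ := max_le ht₀.2 (by linarith [ht.1])
  have hat₀δ : a - t₀ ≤ δ := by
    rw [sub_le_iff_le_add]
    exact max_le (by linarith) (by linarith [ht₀.1])
  have hsub : uIcc a (t + δ) ⊆ uIcc t₀ (t + δ) := by
    rw [uIcc_of_le hat, uIcc_of_le ht₀.2]; exact Icc_subset_Icc_left hat₀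
  have hηa := hη.mono hsub
  have hηSa : ∀ τ ∈ Icc a (t + δ), η τ ∈ Icc 0 ℓ := fun τ hτ => hηS τ ⟨hat₀.trans hτ.1, hτ.2⟩
  have hlip' : ∀ s ∈ Icc 0 ℓ, ∀ t ∈ Icc δ (T + 1), ∀ v : ℝ,
      arcLagrangian H s v (t - δ) ≤ arcLagrangian H s v t + K * (1 + |v|) * δ := by
    intro s hs t ht v
    have habs : |t - δ - t| = δ := by
      rw [show t - δ - t = -δ by ring, abs_neg, abs_of_pos hδ0]
    have := hlip s hs t ⟨by linarith [ht.1], ht.2⟩ (t - δ)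
      ⟨by linarith [ht.1], by linarith [ht.2]⟩ (by rwa [habs]) v
    rwa [habs] at this
  obtain ⟨hi, hdel⟩ := hH.integral_delayed_le hℓ hδ0.le hlip' hC' haδ hat htδ.2 hηa hηSa
    (hint.mono_set hsub)
  have hvarS : ∫ τ in a..(t + δ), (1 + |deriv η τ|) ≤ T + 1 + S := by
    rw [intervalIntegral.integral_add intervalIntegrable_const hηa.intervalIntegrable_deriv.abs,
      intervalIntegral.integral_const, smul_eq_mul, mul_one]
    have h1 := hvar₁ η t₀ (t + δ) ht₀.1 htδ.2 hη hηS hint hQ' a (t + δ) hat₀ hat le_rfl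
    have h2 := le_abs_self (Q + D * (T + 1) + C₁ * (T + 1))
    have h3 : C₁ * (t + δ - a) ≤ C₁ * (T + 1) := by
      gcongr; linarith [htδ.2]
    linarith [htδ.2]
  have hnear : |η a - η t₀| < ρ := by
    have h1 := hvar₂ η t₀ (t + δ) ht₀.1 htδ.2 hη hηS hint hQ' t₀ a le_rfl hat₀ hat
    have h2 := abs_sub_le_integral_abs_deriv hat₀ (hη.mono (by
      rw [uIcc_of_le hat₀, uIcc_of_le ht₀.2]; exact Icc_subset_Icc_right hat))
    have h3 := mul_le_mul_of_nonneg_left h2 hk0.le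
    have h4 : C₂ * (a - t₀) ≤ C₂ * δ := by gcongr
    have h5 := le_abs_self (Q + D * (T + 1))
    have h6 : k * |η a - η t₀| < k * ρ := by linarith
    exact lt_of_mul_lt_mul_left h6 hk0.le
  have hηaS : η a ∈ Icc 0 ℓ := hηSa a ⟨le_rfl, hat⟩
  -- A truncated curve starts at time `0`, where every position is allowed. Otherwise `t₀ ≥ δ > 0`,
  -- so the curve starts on the side `s = ℓ` and still does after translation.
  have hba : (η a, a - δ) ∈ rightParabolicBoundary ℓ := by
    rcases le_total t₀ δ with h | h
    · left
      refine ⟨hηaS, ?_⟩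
      rw [ha, max_eq_right h]; simp
    · rcases hb with ⟨-, h0⟩ | ⟨h0, -⟩
      · have : t₀ = 0 := h0
        linarith
      · right
        rw [ha, max_eq_left h]
        exact ⟨h0, sub_nonneg.2 h⟩
  have hU : U₀ (η a, a - δ) ≤ U₀ (η t₀, t₀) + ε / 4 := by
    have := hUu (η a, a - δ) ⟨hba, mem_univ _, by linarith, by linarith [htδ.2]⟩ (η t₀, t₀)
      ⟨hb, mem_univ _, ht₀T⟩ (by
        rw [Prod.dist_eq]
        refine max_lt hnear (lt_of_le_of_lt ?_ hδρ)
        rw [Real.dist_eq, abs_le]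
        constructor <;> linarith)
    have := (abs_lt.1 this).2
    linarith
  have hadd := integral_add_const_mono (T := δ) hC0 hint (fun τ hτ => hC' _ (hηS τ hτ) τ
    ⟨ht₀.1.trans hτ.1, hτ.2.trans htδ.2⟩ (deriv η τ)) hat₀ hat le_rfl (by linarith)
  have hmem : U₀ (η a, a - δ) + ∫ τ in a..(t + δ), arcLagrangian H (η τ) (deriv η τ) (τ - δ) ∈
      arcCosts ℓ H U₀ s t := by
    have hAC := hηa.comp_add_right hat δ
    have hI := hi.comp_add_right δ
    have hd : ∀ τ, deriv (fun τ => η (τ + δ)) τ = deriv η (τ + δ) := fun τ =>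
      deriv_comp_add_const η δ τ
    rw [add_sub_cancel_right] at hAC hI
    simp only [add_sub_cancel_right] at hI
    refine ⟨a - δ, fun τ => η (τ + δ), ⟨by linarith, by linarith⟩, hAC, fun τ hτ => hηSa _
      ⟨by linarith [hτ.1], by linarith [hτ.2]⟩, hηt, by simpa using hba, by simpa only [hd] using hI,
      ?_⟩
    simp only [hd, sub_add_cancel]
    have := intervalIntegral.integral_comp_add_right (a := a - δ) (b := t)
      (fun τ => arcLagrangian H (η τ) (deriv η τ) (τ - δ)) δ
    simp only [add_sub_cancel_right, sub_add_cancel] at this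
    rw [this]
  have hfin := (isGLB_arcValueFunction hℓ hH hU₀ hs ht.1).1 hmem
  have h1 : K * δ * ∫ τ in a..(t + δ), (1 + |deriv η τ|) ≤ K * δ * (T + 1 + S) := by gcongr
  have h2 : δ * E = C * δ + K * δ * (T + 1 + S) + δ := by rw [hE]; ring
  linarith

/-- Locally uniform control of the value function forward in time. -/
theorem exists_arcValueFunction_le_add_cone (hℓ : 0 ≤ ℓ) (hH : IsArcHamiltonian ℓ H)
    (hU₀ : ContinuousOn U₀ (rightParabolicBoundary ℓ)) (T : ℝ) :
    ∃ C : ℝ, 0 ≤ C ∧ ∀ s ∈ Icc 0 ℓ, ∀ s' ∈ Icc 0 ℓ, ∀ t t' : ℝ, 0 ≤ t → t < t' → t' ≤ T →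
      |s' - s| ≤ t' - t →
      arcValueFunction ℓ H U₀ (s', t') ≤ arcValueFunction ℓ H U₀ (s, t) + C * (t' - t) := by
  obtain ⟨N, hN⟩ := (isCompact_Icc (a := 0) (b := ℓ) |>.prod
    ((isCompact_Icc (a := -1) (b := 1)).prod
    (isCompact_Icc (a := 0) (b := T)))).exists_bound_of_continuousOn
    (hH.continuous_extLagrangian hℓ).continuousOn
  refine ⟨|N|, abs_nonneg N, fun s hs s' hs' t t' ht htt ht' hss => ?_⟩
  have hd : 0 < t' - t := by linarith
  set v := (s' - s) / (t' - t) with hv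
  have hv1 : |v| ≤ 1 := by rwa [hv, abs_div, abs_of_pos hd, div_le_one hd]
  have hvd : v * (t' - t) = s' - s := by rw [hv]; field_simp
  have e1 : s - v * t + v * t = s := by ring
  have e2 : s - v * t + v * t' = s' := by linarith
  have h1 := arcValueFunction_le_add_segment hℓ hH hU₀ (x := s - v * t) (v := v) ht htt.le
    (by rwa [e1]) (by rwa [e2])
  rw [e1, e2] at h1
  have h2 : ‖∫ τ in t..t', extLagrangian ℓ H (s - v * t + v * τ) v τ‖ ≤ |N| * |t' - t| := by
    refine intervalIntegral.norm_integral_le_of_norm_le_const fun r hr => ?_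
    rw [uIoc_of_le htt.le] at hr
    exact (hN (s - v * t + v * r, v, r) ⟨segment_mem_Icc (by rwa [e1]) (by rwa [e2]) r
      ⟨hr.1.le, hr.2⟩, abs_le.1 hv1, ht.trans hr.1.le, hr.2.trans ht'⟩).trans (le_abs_self N)
  have h3 := le_of_abs_le (Real.norm_eq_abs _ ▸ h2)
  rw [abs_of_pos hd] at h3
  linarith

/-- To compare `(s₁, t₁)` with a nearby `(s₂, t₂)`, wait at `s₁` until `t₁ + 2 * ρ / 3`, using the
backward estimate. The later point lies in the unit-speed forward cone of `(s₂, t₂)`, because both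
coordinates differ by less than `ρ / 3`. Exchanging the points gives the other inequality. -/
theorem continuousOn_arcValueFunction (hℓ : 0 ≤ ℓ) (hH : IsArcHamiltonian ℓ H)
    (hU₀ : ContinuousOn U₀ (rightParabolicBoundary ℓ)) :
    ContinuousOn (arcValueFunction ℓ H U₀) (closedArcStrip ℓ) := by
  rintro ⟨s, t⟩ ⟨hs, ht⟩
  have ht : 0 ≤ t := ht
  rw [Metric.continuousWithinAt_iff]
  intro ε hε
  obtain ⟨C, hC0, hC⟩ := exists_arcValueFunction_le_add_cone hℓ hH hU₀ (t + 2)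
  obtain ⟨δ₀, hδ₀, hδ⟩ := exists_arcValueFunction_le_add_time hℓ hH hU₀ (T := t + 1)
    (by linarith) (half_pos hε)
  set ρ := min (min 1 δ₀) (ε / 2 / (2 * C + 1)) with hρ
  have hρ0 : 0 < ρ := by positivity
  have hρ1 : ρ ≤ 1 := (min_le_left _ _).trans (min_le_left _ _)
  have hρ2 : ρ ≤ δ₀ := (min_le_left _ _).trans (min_le_right _ _)
  have hρ3 : ρ * (2 * C + 1) ≤ ε / 2 :=
    (le_div_iff₀ (by positivity)).1 (min_le_right _ _)
  have key : ∀ s₁ ∈ Icc 0 ℓ, ∀ s₂ ∈ Icc 0 ℓ, ∀ t₁ ∈ Icc 0 (t + 1), ∀ t₂ ∈ Icc 0 (t + 1),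
      |s₁ - s₂| < ρ / 3 → |t₁ - t₂| < ρ / 3 →
      arcValueFunction ℓ H U₀ (s₁, t₁) < arcValueFunction ℓ H U₀ (s₂, t₂) + ε := by
    intro s₁ hs₁ s₂ hs₂ t₁ ht₁ t₂ ht₂ hss htt
    have hss' := abs_lt.1 hss
    have htt' := abs_lt.1 htt
    have h1 := hδ (2 * ρ / 3) ⟨by positivity, by linarith⟩ s₁ hs₁ t₁ ht₁
    have h2 := hC s₂ hs₂ s₁ hs₁ t₂ (t₁ + 2 * ρ / 3) ht₂.1 (by linarith) (by linarith [ht₁.2])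
      (by linarith)
    have h3 : C * (t₁ + 2 * ρ / 3 - t₂) ≤ C * ρ := by gcongr; linarith
    have h4 : 0 ≤ C * ρ := by positivity
    linarith
  refine ⟨ρ / 3, by positivity, ?_⟩
  rintro ⟨s', t'⟩ ⟨hs', ht'⟩ hdist
  have ht' : 0 ≤ t' := ht'
  rw [Prod.dist_eq, max_lt_iff] at hdist
  obtain ⟨h1, h2⟩ := hdist
  simp only [Real.dist_eq] at h1 h2
  have h2' := abs_lt.1 h2
  have hmem : t ∈ Icc 0 (t + 1) := ⟨ht, by linarith⟩
  have hmem' : t' ∈ Icc 0 (t + 1) := ⟨ht', by linarith⟩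
  rw [Real.dist_eq, abs_sub_lt_iff]
  have k1 := key s' hs' s hs t' hmem' t hmem h1 h2
  have k2 := key s hs s' hs' t hmem t' hmem' (by rwa [abs_sub_comm]) (by rwa [abs_sub_comm])
  constructor <;> linarith

end continuity

/-! ### The maximality theorem. -/

/-- The local value function on an arc of length `ℓ` is a well-defined (finite) infimum, and is the
maximal continuous subsolution of the local Hamilton-Jacobi equation not exceeding `U₀` on the
partial parabolic boundary. -/
theorem mainTheorem10 (ℓ : ℝ) (hℓ : 0 < ℓ) (H : ℝ → ℝ → ℝ → ℝ) (hH : IsArcHamiltonian ℓ H)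
    (U₀ : ℝ × ℝ → ℝ) (hU₀ : ContinuousOn U₀ (rightParabolicBoundary ℓ)) :
    (∀ s t : ℝ, (s, t) ∈ closedArcStrip ℓ →
      IsGLB (arcCosts ℓ H U₀ s t) (arcValueFunction ℓ H U₀ (s, t))) ∧
    ContinuousOn (arcValueFunction ℓ H U₀) (closedArcStrip ℓ) ∧
    IsViscositySubsolution ℓ H (arcValueFunction ℓ H U₀) ∧
    (∀ p ∈ rightParabolicBoundary ℓ, arcValueFunction ℓ H U₀ p ≤ U₀ p) ∧
    (∀ W : ℝ × ℝ → ℝ, ContinuousOn W (closedArcStrip ℓ) → IsViscositySubsolution ℓ H W →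
      (∀ p ∈ rightParabolicBoundary ℓ, W p ≤ U₀ p) →
      ∀ p ∈ closedArcStrip ℓ, W p ≤ arcValueFunction ℓ H U₀ p) := by
  refine ⟨fun s t hst => isGLB_arcValueFunction hℓ.le hH hU₀ hst.1 hst.2,
    continuousOn_arcValueFunction hℓ.le hH hU₀,
    isViscositySubsolution_arcValueFunction hℓ.le hH hU₀,
    fun p hp => arcValueFunction_le_boundary hℓ.le hH hU₀ hp, ?_⟩
  rintro W hW hsub hle ⟨s, t⟩ ⟨hs, ht⟩
  -- It is enough to bound `W` by the cost of each competitor: its growth is at most the action, and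
  -- `W ≤ U₀` at the starting point.
  refine (isGLB_arcValueFunction hℓ.le hH hU₀ hs ht).2 ?_
  dsimp only
  rintro c ⟨t₀, η, ht₀, hη, hηS, rfl, hb, hint, rfl⟩
  have := hsub.sub_le_action hℓ hH hW ht₀.1 ht₀.2 hη hηS hint
  linarith [hle _ hb]
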